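/- **Definitions.** Let $L$ be a set of indices of variables. A $*$-test graph $T=(V,E,\gamma,\varepsilon)$ in variables $(x_l)_{l\in L}$ is a finite, nonempty, connected, oriented multigraph $(V,E)$ (loops allowed) with maps $\gamma:E\to L$, $\varepsilon:E\to\{1,*\}$; the edge $e$ is labelled $x_{\gamma(e)}^{\varepsilon(e)}$. It is *cyclic* if there is a closed walk visiting each edge exactly once, in the sense of its orientation (the graph with a single vertex and no edge is cyclic). For a family $\mathbf A=(A_l)_{l\in L}$ of complex $N\times N$ matrices, $$\tau_N[T(\mathbf A)]=\frac1N\sum_{\phi:V\to\{1,\dots,N\}}\ \prod_{e=(v,w)\in E}A_{\gamma(e)}^{\varepsilon(e)}(\phi(v),\phi(w)),$$ and $\tau_N^0[T(\mathbf A)]$ is the same sum restricted to injective $\phi$. For a partition $\pi$ of $V$, $T^\pi$ is the graph obtained by identifying the vertices in a same block. For a functional $\tau$ on cyclic $*$-test graphs, $\tau^0[T]=\sum_\pi\tau[T^\pi]\mu_V(\pi)$, with $\mu_V(\pi)=\mu(0,\pi)$ the Möbius function of the lattice of partitions of $V$. A *cutting edge* of $T$ is an edge whose removal disconnects $T$;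 the *tree of two-edge connected components* of $T$ has for vertices the connected components left when all cutting edges are removed, two distinct components being adjacent when a cutting edge joins them; $\mathfrak r(T)$ is the number of its leaves, with $\mathfrak r(T)=2$ if the tree is a single vertex. If the variables are split into $p$ families, the *components* of $T$ are the connected components, having at least one edge, of the subgraphs formed by the edges labelled in the $j$-th family, $j=1,\dots,p$. $G_{red}(T)$ is the bipartite graph whose vertices are the components of $T$ and the vertices of $T$ that belong to at least two components, with an edge between a component and each such vertex that it contains. $T$ is a *free product* if $G_{red}(T)$ is a tree; the graph without edges counts as a free product (with no component). The *traffic-free product* of functionals $\tau_1,\dots,\tau_p$ is the functional $\tau$ on cyclic $*$-test graphs in all the variables given by $\tau[T]=\sum_\pi\kappa[T^\pi]$, where $\kappa[T]=\prod_{\tilde T}\tau^0_{j(\tilde T)}[\tilde T]$ if $T$ is a free product (product over the components $\tilde T$ of $T$, with $j(\tilde T)$ the family labelling $\tilde T$) and $\kappa[T]=0$ otherwise. **Theorem.** Let $p\ge1$ and for each $N$ let $\mathbf X_1^{(N)},\dots,\mathbf X_p^{(N)}$ be families of random $N\times N$ complex matrices defined on a common probability space (the index set of each family not depending on $N$). Assume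 that 1. for each $N$, the families $\mathbf X_1^{(N)},\dots,\mathbf X_p^{(N)}$ are independent; 2. for all $j\in\{1,\dots,p\}$ except possibly one, for all $N$ and all permutation matrices $U$ of size $N$, $U\mathbf X_j^{(N)}U^*$ has the same law as $\mathbf X_j^{(N)}$; 3. (Assumption 1) for each $j$, the entries of $\mathbf X_j^{(N)}$ have finite moments of any order and, for each cyclic $*$-test graph $T$, $\mathbb E\big[\tau_N[T(\mathbf X_j^{(N)})]\big]\to\tau_j[T]$ as $N\to\infty$; 4. (Assumption 2) for each $j$ and all cyclic $*$-test graphs $T_1,\dots,T_n$, $\mathbb E\big[\prod_{i}\tau_N[T_i(\mathbf X_j^{(N)})]\big]\to\prod_i\tau_j[T_i]$; 5. (Assumption 3) for each $j$ and all, not necessarily cyclic, $*$-test graphs $T_1,\dots,T_n$, $\mathbb E\big[\prod_{i}\tau_N[T_i(\mathbf X_j^{(N)})]\big]=O\big(N^{\sum_i(\mathfrak r(T_i)/2-1)}\big)$. Then: * the joint family $\mathbf X^{(N)}=(\mathbf X_1^{(N)},\dots,\mathbf X_p^{(N)})$ has entries with finite moments of any order and, for each cyclic $*$-test graph $T$,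 $\mathbb E\big[\tau_N[T(\mathbf X^{(N)})]\big]\to\tau[T]$, where $\tau$ is the traffic-free product of $\tau_1,\dots,\tau_p$; * the families are asymptotically traffic-free: for each cyclic $*$-test graph $T$, $\tau^0[T]=\prod_{\tilde T}\tau^0[\tilde T]$ (product over the components of $T$) if $T$ is a free product, and $\tau^0[T]=0$ otherwise; * for each cyclic $*$-test graph $T$ that is not a free product, $\mathbb E\big[\tau^0_N[T(\mathbf X^{(N)})]\big]=O(N^{-1})$; * in particular, the joint family has a limiting $*$-distribution, which depends only on $\tau_1,\dots,\tau_p$: for each $*$-polynomial $Q$, $\mathbb E\big[\frac1N\mathrm{Tr}\,Q(\mathbf X^{(N)})\big]\to\Phi(Q)$, where $\Phi$ is the linear form given on a word $w$ of length $K$ by $\Phi(w)=\tau[T_w]$, $T_w$ being the directed cycle of length $K$ whose consecutive edges are labelled by the letters of $w$ (a single vertex if $K=0$). -/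

import Mathlib

open MeasureTheory ProbabilityTheory Filter Topology Asymptotics
open scoped Matrix BigOperators

namespace Traffic

universe u

/-- The σ-algebra generated by the entries on the space of complex `N × N` matrices. -/
noncomputable instance matrixMeasurableSpace (N : ℕ) : MeasurableSpace (Matrix (Fin N) (Fin N) ℂ) :=
  inferInstanceAs (MeasurableSpace (Fin N → Fin N → ℂ))

/-! ### Labelled graphs, test graphs -/

/-- A finite oriented multigraph (loops and multiple edges allowed) whose edges `e` carry a label
`x_{γ e}` or `x_{γ e}^*`, for variables `x_l` indexed by `l : L`; `ε e = true` means the star.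
A `*`-test graph is such a graph that is connected, see `IsTest`. -/
structure StarGraph (L : Type u) where
  V : Type
  E : Type
  [fintypeV : Fintype V]
  [fintypeE : Fintype E]
  src : E → V
  tgt : E → V
  γ : E → L
  ε : E → Bool

attribute [instance] StarGraph.fintypeV StarGraph.fintypeE

namespace StarGraph

variable {L : Type u}

/-- Two vertices are equivalent when they are joined by an (unoriented) path in the edges of `S`. -/
def joinedBy (T : StarGraph L) (S : Set T.E) : Setoid T.V :=
  Relation.EqvGen.setoid (fun v w => ∃ e ∈ S, T.src e = v ∧ T.tgt e = w)

/-- `T` is a `*`-test graph: it is (nonempty and) connected. -/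
def IsTest (T : StarGraph L) : Prop :=
  Nonempty T.V ∧ ∀ v w, T.joinedBy Set.univ v w

/-- `T` is a cyclic `*`-test graph: there is a closed walk visiting each edge exactly once, in the
sense of its orientation. (The graph with one vertex and no edge is cyclic.) -/
def IsCyclic (T : StarGraph L) : Prop :=
  T.IsTest ∧ ∃ c : Fin (Fintype.card T.E) ≃ T.E,
    ∀ k, T.tgt (c k) = T.src (c (finRotate _ k))

/-- The graph `T^π` obtained by identifying the vertices in a same block of the partition `π`. -/
noncomputable def quot (T : StarGraph L) (π : Setoid T.V) : StarGraph L where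
  V := Quotient π
  E := T.E
  fintypeV := Fintype.ofFinite _
  src e := Quotient.mk π (T.src e)
  tgt e := Quotient.mk π (T.tgt e)
  γ := T.γ
  ε := T.ε

/-- Change of variables along a map of index sets. -/
def map {L' : Type*} (f : L → L') (T : StarGraph L) : StarGraph L' where
  V := T.V
  E := T.E
  src := T.src
  tgt := T.tgt
  γ e := f (T.γ e)
  ε := T.ε

/-! ### The tree of two-edge connected components -/

/-- A cutting edge: its removal disconnects the graph. -/
def IsCutting (T : StarGraph L) (e : T.E) : Prop :=
  ¬ ∀ v w, T.joinedBy {e}ᶜ v w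

/-- The two-edge connected components of `T`, i.e. the connected components left when all the
cutting edges are removed. -/
abbrev TwoEdgeComp (T : StarGraph L) : Type :=
  Quotient (T.joinedBy {e | ¬ T.IsCutting e})

/-- The tree of two-edge connected components: distinct components are adjacent when a cutting edge
goes from one to the other. -/
def compTree (T : StarGraph L) : SimpleGraph T.TwoEdgeComp :=
  SimpleGraph.fromRel fun C D => ∃ e, T.IsCutting e ∧
    Quotient.mk _ (T.src e) = C ∧ Quotient.mk _ (T.tgt e) = D

open Classical in
/-- The number `𝔯(T)` of leaves of the tree of two-edge connected components, the trivial tree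
having two leaves by convention. -/
noncomputable def numLeaves (T : StarGraph L) : ℕ :=
  if Subsingleton T.TwoEdgeComp then 2 else Nat.card {C // ∃! D, T.compTree.Adj C D}

end StarGraph

/-! ### Traces and injective traces -/

section Traces

variable {L : Type u} {N : ℕ}

/-- The matrix substituted for the letter `x_l` (or `x_l^*` when the boolean is `true`). -/
def letter (A : L → Matrix (Fin N) (Fin N) ℂ) (x : L × Bool) : Matrix (Fin N) (Fin N) ℂ :=
  if x.2 then (A x.1)ᴴ else A x.1

open Classical in
/-- The trace `τ_N[T(A)]`. -/
noncomputable def trace (T : StarGraph L) (A : L → Matrix (Fin N) (Fin N) ℂ) : ℂ :=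
  (N : ℂ)⁻¹ * ∑ φ : T.V → Fin N,
    ∏ e : T.E, letter A (T.γ e, T.ε e) (φ (T.src e)) (φ (T.tgt e))

open Classical in
/-- The injective trace `τ⁰_N[T(A)]`. -/
noncomputable def injTrace (T : StarGraph L) (A : L → Matrix (Fin N) (Fin N) ℂ) : ℂ :=
  (N : ℂ)⁻¹ * ∑ φ : T.V ↪ Fin N,
    ∏ e : T.E, letter A (T.γ e, T.ε e) (φ (T.src e)) (φ (T.tgt e))

end Traces

/-! ### The injective version of a functional on test graphs -/

instance finiteSetoid (V : Type) [Finite V] : Finite (Setoid V) :=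
  Finite.of_injective (fun s : Setoid V => s.r) fun _ _ h =>
    Setoid.ext fun x y => iff_of_eq (congrFun (congrFun h x) y)

noncomputable instance fintypeSetoid (V : Type) [Finite V] : Fintype (Setoid V) :=
  Fintype.ofFinite _

open Classical in
noncomputable instance locallyFiniteSetoid (V : Type) [Finite V] : LocallyFiniteOrder (Setoid V) :=
  Fintype.toLocallyFiniteOrder

open Classical in
/-- The Möbius function `μ_V(π) = μ(0, π)` of the lattice of partitions of `V`. -/
noncomputable def moebius (V : Type) [Finite V] (π : Setoid V) : ℂ :=
  IncidenceAlgebra.mu ℂ (⊥ : Setoid V) π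

/-- The injective version `τ⁰` of `τ`: `τ⁰[T] = ∑_π τ[T^π] μ_V(π)`. -/
noncomputable def injVersion {L : Type u} (τ : StarGraph L → ℂ) (T : StarGraph L) : ℂ :=
  ∑ π : Setoid T.V, τ (T.quot π) * moebius T.V π

/-! ### Free products of test graphs, in families of variables `x_j = (x_{j,l})_{l : ι j}` -/

namespace StarGraph

variable {p : ℕ} {ι : Fin p → Type u}

/-- Vertices joined by a path of edges labelled in the `j`-th family. -/
def joinedIn (T : StarGraph (Σ j, ι j)) (j : Fin p) : Setoid T.V :=
  T.joinedBy {e | (T.γ e).1 = j}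

/-- The connected components of `T` labelled with variables in a same family: a family `j` and a
connected component, having at least one edge, of the graph of the edges labelled in the `j`-th
family. -/
abbrev ColorComp (T : StarGraph (Σ j, ι j)) : Type :=
  {C : Σ j : Fin p, Quotient (T.joinedIn j) //
    ∃ e, (T.γ e).1 = C.1 ∧ Quotient.mk _ (T.src e) = C.2}

noncomputable instance (T : StarGraph (Σ j, ι j)) : Fintype T.ColorComp := Fintype.ofFinite _

/-- `v` is a vertex of the component `C`. -/
def MemComp (T : StarGraph (Σ j, ι j)) (v : T.V) (C : T.ColorComp) : Prop :=
  Quotient.mk (T.joinedIn C.1.1) v = C.1.2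

theorem mk_tgt_eq (T : StarGraph (Σ j, ι j)) (e : T.E) {j : Fin p} (h : (T.γ e).1 = j) :
    Quotient.mk (T.joinedIn j) (T.tgt e) = Quotient.mk (T.joinedIn j) (T.src e) :=
  Quotient.sound (Setoid.symm' (T.joinedIn j) (Relation.EqvGen.rel _ _ ⟨e, h, rfl, rfl⟩))

/-- The component `C`, as a graph in the variables of its own family. -/
noncomputable def comp (T : StarGraph (Σ j, ι j)) (C : T.ColorComp) : StarGraph (ι C.1.1) where
  V := {v : T.V // T.MemComp v C}
  E := {e : T.E // (T.γ e).1 = C.1.1 ∧ T.MemComp (T.src e) C}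
  fintypeV := Fintype.ofFinite _
  fintypeE := Fintype.ofFinite _
  src e := ⟨T.src e.1, e.2.2⟩
  tgt e := ⟨T.tgt e.1, (T.mk_tgt_eq e.1 e.2.1).trans e.2.2⟩
  γ e := e.2.1 ▸ (T.γ e.1).2
  ε e := T.ε e.1

/-- The vertices of `T` that are common to several components. -/
abbrev Connector (T : StarGraph (Σ j, ι j)) : Type :=
  {v : T.V // ∃ C D : T.ColorComp, C ≠ D ∧ T.MemComp v C ∧ T.MemComp v D}

/-- The bipartite graph `G_red(T)` on the components and the common vertices, with an edge between
`C` and `v` when `v` is a vertex of `C`. -/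
def redGraph (T : StarGraph (Σ j, ι j)) : SimpleGraph (T.ColorComp ⊕ T.Connector) :=
  SimpleGraph.fromRel fun a b => ∃ (C : T.ColorComp) (v : T.Connector),
    a = Sum.inl C ∧ b = Sum.inr v ∧ T.MemComp v.1 C

/-- `T` is a free product: `G_red(T)` is a tree. A graph without edge, for which `G_red(T)` is empty,
is counted as a free product (with no factor). -/
def IsFreeProduct (T : StarGraph (Σ j, ι j)) : Prop :=
  IsEmpty T.E ∨ T.redGraph.IsTree

end StarGraph

section Freeness

variable {p : ℕ} {ι : Fin p → Type u}

/-- The rule of traffic-freeness for a functional `τ` on cyclic test graphs, all whose ingredients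
come from `τ`: `τ⁰[T]` is the product of the `τ⁰` of the components of `T` if `T` is a free product,
and is `0` otherwise. -/
def IsTrafficFree (τ : StarGraph (Σ j, ι j) → ℂ) : Prop :=
  ∀ T : StarGraph (Σ j, ι j), T.IsCyclic →
    (T.IsFreeProduct →
      injVersion τ T = ∏ C : T.ColorComp, injVersion τ ((T.comp C).map (Sigma.mk C.1.1))) ∧
    (¬ T.IsFreeProduct → injVersion τ T = 0)

open Classical in
/-- The injective version of the traffic-free product of `τ_1, …, τ_p`. -/
noncomputable def freeProductInj (τ : ∀ j, StarGraph (ι j) → ℂ) (T : StarGraph (Σ j, ι j)) : ℂ :=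
  if T.IsFreeProduct then ∏ C : T.ColorComp, injVersion (τ C.1.1) (T.comp C) else 0

/-- The traffic-free product of `τ_1, …, τ_p`: `τ[T] = ∑_π τ⁰[T^π]`. -/
noncomputable def trafficFreeProduct (τ : ∀ j, StarGraph (ι j) → ℂ)
    (T : StarGraph (Σ j, ι j)) : ℂ :=
  ∑ π : Setoid T.V, freeProductInj τ (T.quot π)

end Freeness

/-! ### Random matrices: the three assumptions -/

section Random

variable {L : Type u} {Ω : ℕ → Type*} [∀ N, MeasurableSpace (Ω N)]

/-- The family of random matrices has a limiting distribution of traffics `τ` on cyclic test graphs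
(only the values of `τ` at cyclic test graphs matter): the entries have finite moments of any order
and `E[τ_N[T(A_N)]] → τ[T]` for any cyclic test graph `T`. -/
def HasLimitingTraffic (P : ∀ N, Measure (Ω N))
    (A : ∀ N, Ω N → L → Matrix (Fin N) (Fin N) ℂ) (τ : StarGraph L → ℂ) : Prop :=
  (∀ N l i j (q : ℕ), MemLp (fun ω => A N ω l i j) q (P N)) ∧
  ∀ T : StarGraph L, T.IsCyclic →
    Tendsto (fun N => ∫ ω, trace T (A N ω) ∂P N) atTop (𝓝 (τ T))

/-- Concentration: for cyclic test graphs `T_1, …, T_n`,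
`E[τ_N[T_1(A_N)] ⋯ τ_N[T_n(A_N)]] → τ[T_1] ⋯ τ[T_n]`. -/
def Concentrates (P : ∀ N, Measure (Ω N))
    (A : ∀ N, Ω N → L → Matrix (Fin N) (Fin N) ℂ) (τ : StarGraph L → ℂ) : Prop :=
  ∀ (n : ℕ) (T : Fin n → StarGraph L), (∀ i, (T i).IsCyclic) →
    Tendsto (fun N => ∫ ω, ∏ i, trace (T i) (A N ω) ∂P N) atTop (𝓝 (∏ i, τ (T i)))

/-- Control of growth: for (not necessarily cyclic) test graphs `T_1, …, T_n`,
`E[τ_N[T_1(A_N)] ⋯ τ_N[T_n(A_N)]] = O(N^{∑_i (𝔯(T_i)/2 - 1)})`. -/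
def ControlledGrowth (P : ∀ N, Measure (Ω N))
    (A : ∀ N, Ω N → L → Matrix (Fin N) (Fin N) ℂ) : Prop :=
  ∀ (n : ℕ) (T : Fin n → StarGraph L), (∀ i, (T i).IsTest) →
    (fun N => ∫ ω, ∏ i, trace (T i) (A N ω) ∂P N) =O[atTop]
      fun N => (N : ℝ) ^ (∑ i, (((T i).numLeaves : ℝ) / 2 - 1))

/-- Invariance in law under conjugation by permutation matrices. -/
def PermInvariant (P : ∀ N, Measure (Ω N))
    (A : ∀ N, Ω N → L → Matrix (Fin N) (Fin N) ℂ) : Prop :=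
  ∀ (N : ℕ) (σ : Equiv.Perm (Fin N)),
    IdentDistrib (fun ω l => σ.permMatrix ℂ * A N ω l * (σ.permMatrix ℂ)ᴴ) (A N) (P N) (P N)

/-- The joint family. -/
def joint {p : ℕ} {ι : Fin p → Type u}
    (X : ∀ j, ∀ N, Ω N → ι j → Matrix (Fin N) (Fin N) ℂ) :
    ∀ N, Ω N → (Σ j, ι j) → Matrix (Fin N) (Fin N) ℂ :=
  fun N ω x => X x.1 N ω x.2

end Random

/-! ### `*`-distributions. The `*`-polynomials in `x` are the elements of the free algebra on the
letters `x_l` (boolean `false`) and `x_l^*` (boolean `true`). -/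

section StarDistribution

variable {L : Type u}

/-- The cyclic test graph of the word `w_0 ⋯ w_{K-1}`: vertices `0, …, K-1` (one vertex if `K = 0`)
and edges `k → k+1` modulo `K` labelled `w_k`. -/
def wordGraph (w : List (L × Bool)) : StarGraph L where
  V := Fin (w.length - 1 + 1)
  E := Fin w.length
  src k := Fin.ofNat _ k.1
  tgt k := Fin.ofNat _ (k.1 + 1)
  γ k := (w.get k).1
  ε k := (w.get k).2

/-- The matrix `Q(A)` for a `*`-polynomial `Q`. -/
noncomputable def evalPoly {N : ℕ} (A : L → Matrix (Fin N) (Fin N) ℂ)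
    (Q : FreeAlgebra ℂ (L × Bool)) : Matrix (Fin N) (Fin N) ℂ :=
  FreeAlgebra.lift ℂ (letter A) Q

/-- The `*`-distribution induced by `τ`: the linear form with value `τ[T_w]` at each word `w`. -/
noncomputable def starDistribution (τ : StarGraph L → ℂ) (Q : FreeAlgebra ℂ (L × Bool)) : ℂ :=
  Finsupp.sum (FreeAlgebra.equivMonoidAlgebraFreeMonoid Q).coeff
    fun w c => c * τ (wordGraph (FreeMonoid.toList w))

end StarDistribution

end Traffic

/-! For an injective map of the vertices, independence splits the expected weight of `T` into one
factor per family. Permutation invariance makes every factor but one independent of the map, so each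
factor may be replaced by its average. Hence `integral_injTrace_joint`: with `n` vertices and
`(N)_n` the falling factorial, the expected injective trace is `N⁻¹ (N)_n ∏_j (N)_n⁻¹ E[S_j]`, where
`S_j` sums the weights of the edges of colour `j` over injective maps. It remains to find the order
of each `S_j`.

Möbius inversion writes `S_j` through sums over all maps constant on the blocks of a partition `π`.
Such a sum is `N` to the number of connected components of the quotient, times the product of their
traces. By controlled growth it is `O(N^{ℓ/2})` in expectation, `ℓ` being the total number of leaves
of the components.

The combinatorial heart is a bound on leaves. Consider the bipartite graph joining each vertex of
`T`, for each colour `j`, to its class under the edges of colour `j`. It is connected, with `p n`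
edges and `n + ∑ c_j` vertices, so `∑ c_j + n ≤ p n + 1`. Equality says that it is a tree, that is,
that `T` is a free product (`isFreeProduct_iff`). As soon as equality fails, `sum_numLeaves_le`
bounds the leaves of all colours together by `2(p-1)n`. The reason is that a cyclic graph has no
bridge: a cutting edge inside one colour must be bypassed through other colours, which spends edges
of the bipartite graph (`leaf_count`).

If `T` is not a free product, then `∏_j E[S_j] = O(N^{(p-1)n})` and the injective trace is `O(N⁻¹)`.
If it is, the main part of `S_j` sums over the maps injective on each component; it factorizes into
injective traces of components, which are again cyclic, and concentration gives the limit. The rest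
of `S_j` only involves partitions merging distinct components, and the same leaf bound makes it
smaller by a factor `N`. Summing over quotients of `T` gives convergence of traces; words are the
case of directed cycles. -/

namespace Traffic

universe u

/-! ### Paths in multigraphs: how the number of classes varies with the edges -/

section Joined

variable {W F : Type*} {s t : F → W}

/-- Two vertices of the multigraph with edges `s e → t e` are equivalent when they are joined by a
path in the edges of `S`. -/
def joined (s t : F → W) (S : Set F) : Setoid W :=
  Relation.EqvGen.setoid (fun v w => ∃ e ∈ S, s e = v ∧ t e = w)

theorem joined_edge {S : Set F} {e : F} (h : e ∈ S) : joined s t S (s e) (t e) :=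
  Relation.EqvGen.rel _ _ ⟨e, h, rfl, rfl⟩

theorem joined_le {S : Set F} {r : Setoid W} (h : ∀ e ∈ S, r (s e) (t e)) : joined s t S ≤ r := by
  intro a b hab
  induction hab with
  | rel x y h' => obtain ⟨e, he, rfl, rfl⟩ := h'; exact h e he
  | refl x => exact r.refl x
  | symm x y _ ih => exact r.symm ih
  | trans x y z _ _ ih1 ih2 => exact r.trans ih1 ih2

theorem joined_mono {S R : Set F} (h : S ⊆ R) : joined s t S ≤ joined s t R :=
  joined_le fun _ he => joined_edge (h he)

theorem eq_of_joined {X : Type*} {S : Set F} (g : W → X) (h : ∀ e ∈ S, g (s e) = g (t e)) {a b : W}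
    (hab : joined s t S a b) : g a = g b :=
  joined_le (r := Setoid.ker g) h hab

/-- A new edge can only make the class of `s e` disappear into that of `t e`. Sending this class to
`none` and every other one to its image is injective. -/
theorem card_quotient_joined_le_insert [Finite W] (S : Set F) (e : F) :
    Nat.card (Quotient (joined s t S)) ≤ Nat.card (Quotient (joined s t (insert e S))) + 1 := by
  classical
  let q : W → Quotient (joined s t S) := Quotient.mk _
  let r : W → Quotient (joined s t S) := fun w => if q w = q (s e) then q (t e) else q w
  have hr : ∀ {a b}, joined s t (insert e S) a b → r a = r b := by
    intro a b hab
    refine eq_of_joined r ?_ hab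
    rintro e' (rfl | he')
    · simp only [r, if_true]
      split_ifs <;> rfl
    · have : q (s e') = q (t e') := Quotient.sound (joined_edge he')
      simp only [r, this]
  let g : Quotient (joined s t S) → Option (Quotient (joined s t (insert e S))) := fun x =>
    if x = q (s e) then none
    else some (Quotient.map' id (fun a b h => joined_mono (Set.subset_insert e S) h) x)
  have hg : Function.Injective g := by
    intro x y hxy
    induction x using Quotient.inductionOn with | _ a
    induction y using Quotient.inductionOn with | _ b
    change q a = q b
    simp only [g] at hxy
    by_cases ha : q a = q (s e) <;> by_cases hb : q b = q (s e)
    · rw [ha, hb]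
    · rw [if_pos ha, if_neg hb] at hxy; cases hxy
    · rw [if_neg ha, if_pos hb] at hxy; cases hxy
    · rw [if_neg ha, if_neg hb] at hxy
      have := hr (Quotient.exact (Option.some.inj hxy))
      simpa [r, ha, hb] using this
  have := Nat.card_le_card_of_injective g hg
  rwa [Finite.card_option] at this

theorem card_quotient_joined_le_union [Finite W] (S : Set F) (R : Finset F) :
    Nat.card (Quotient (joined s t S)) ≤ Nat.card (Quotient (joined s t (S ∪ ↑R))) + R.card := by
  classical
  induction R using Finset.induction_on with
  | empty => simp
  | insert e R he ih =>
    have h2 := card_quotient_joined_le_insert (s := s) (t := t) (S ∪ ↑R) e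
    rw [Finset.card_insert_of_notMem he, Finset.coe_insert, Set.union_insert]
    omega

/-- If `a` is incident to no edge of `S` other than `e₀`, then `e₀` can be dropped from the paths
joining vertices other than `a`. -/
theorem joined_diff_pendant {S : Set F} {a c : W} {e₀ : F}
    (h0 : s e₀ = a ∧ t e₀ = c ∨ s e₀ = c ∧ t e₀ = a)
    (ha : ∀ e ∈ S, e ≠ e₀ → s e ≠ a ∧ t e ≠ a) {x y : W} (hx : x ≠ a) (hy : y ≠ a)
    (hxy : joined s t S x y) : joined s t (S \ {e₀}) x y := by
  classical
  let q : W → Quotient (joined s t (S \ {e₀})) := Quotient.mk _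
  -- Moving `a` onto `c` turns `e₀` into a loop and affects no other edge, so the resulting class is
  -- constant along `S`.
  have := eq_of_joined (fun w => if w = a then q c else q w) (S := S) (s := s) (t := t) ?_ hxy
  · simp only [if_neg hx, if_neg hy] at this
    exact Quotient.exact this
  · intro e he
    by_cases h : e = e₀
    · subst h
      rcases h0 with ⟨h1, h2⟩ | ⟨h1, h2⟩ <;> by_cases hc : c = a <;> simp [h1, h2, hc]
    · simp only [if_neg (ha e he h).1, if_neg (ha e he h).2]
      exact Quotient.sound (joined_edge ⟨he, h⟩)

/-- In a connected multigraph, the number of vertices incident to an edge of a nonempty set `S` is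
at least `|S| - |F| + |W|`. -/
theorem card_add_card_le_of_connected [Fintype W] [Fintype F] (hconn : ∀ a b, joined s t Set.univ a b)
    (S : Finset F) (hS : S.Nonempty) (U : Finset W)
    (hU : ∀ w ∉ U, ∀ e ∈ S, s e ≠ w ∧ t e ≠ w) :
    S.card + Fintype.card W ≤ Fintype.card F + U.card := by
  classical
  -- The `|F| - |S|` edges outside `S` reduce the classes of `S` to a single one.
  have h1 := card_quotient_joined_le_union (s := s) (t := t) (S : Set F) Sᶜ
  have h2 : (S : Set F) ∪ ↑Sᶜ = Set.univ := by simp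
  rw [h2] at h1
  have h3 : Nat.card (Quotient (joined s t Set.univ)) ≤ 1 := by
    have : Subsingleton (Quotient (joined s t Set.univ)) := by
      constructor
      intro x y
      induction x using Quotient.inductionOn
      induction y using Quotient.inductionOn
      exact Quotient.sound (hconn _ _)
    exact Finite.card_le_one_iff_subsingleton.2 this
  obtain ⟨e₁, he₁⟩ := hS
  -- Each vertex outside `U` is alone in its class, and the class of `s e₁` is one more: this is
  -- where `S` must be nonempty.
  let g : Option {w // w ∉ U} → Quotient (joined s t (S : Set F)) := fun o =>
    Quotient.mk _ (o.elim (s e₁) Subtype.val)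
  have hiso : ∀ w ∉ U, ∀ b, joined s t (S : Set F) w b → w = b := by
    intro w hw b hb
    have := eq_of_joined (fun x => decide (x = w)) (S := (S : Set F)) (s := s) (t := t) ?_ hb
    · simpa [eq_comm] using this
    · intro e he
      simp [(hU w hw e he).1, (hU w hw e he).2]
  have hg : Function.Injective g := by
    have key : ∀ (w : {w // w ∉ U}) (o), g (some w) = g o → some w = o := by
      intro w o h
      have := hiso w.1 w.2 _ (Quotient.exact h)
      cases o with
      | none => exact absurd this.symm (hU w.1 w.2 e₁ he₁).1
      | some v => exact congrArg some (Subtype.ext this)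
    intro x y h
    cases x with
    | some w => exact key w y h
    | none =>
      cases y with
      | none => rfl
      | some w => exact (key w none h.symm).symm
  have h4 := Nat.card_le_card_of_injective g hg
  rw [Finite.card_option, Nat.card_eq_fintype_card, Fintype.card_subtype_compl] at h4
  have h5 : Fintype.card {w // w ∈ U} = U.card := Fintype.card_coe U
  have h6 : U.card ≤ Fintype.card W := Finset.card_le_univ U
  have h7 := Finset.card_add_card_compl S
  omega

end Joined

/-! ### The inequality on leaves -/

section Counting

variable {V B I Q : Type} [Fintype Q]

open Classical in
/-- The number of half-edges at `b`. -/
noncomputable def halfDegree (s t : Q → B) (b : B) : ℕ :=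
  (Finset.univ.filter fun e => s e = b).card + (Finset.univ.filter fun e => t e = b).card

theorem halfDegree_eq (s t : Q → B) (b : B) [DecidablePred fun e => s e = b]
    [DecidablePred fun e => t e = b] : halfDegree s t b =
      (Finset.univ.filter fun e => s e = b).card + (Finset.univ.filter fun e => t e = b).card := by
  unfold halfDegree
  congr!

variable [Fintype V] [Fintype B] [Fintype I]

open Classical in
/-- Consider the connected graph with vertices `V ⊔ B`, edges `I` between `V` and `B`, and edges
`Q` inside `B`, no edge of `Q` being a bridge. This bounds the number of vertices of `B`
having at most one half-edge in `Q`. -/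
theorem leaf_count (x : I → V) (y : I → B) (s t : Q → B) [Nonempty Q]
    (h : ∀ e₀ : Q, ∀ a b : V ⊕ B,
      joined (Sum.elim (Sum.inl ∘ x) (Sum.inr ∘ s)) (Sum.elim (Sum.inr ∘ y) (Sum.inr ∘ t))
        {Sum.inr e₀}ᶜ a b) :
    (Finset.univ.filter fun b => halfDegree s t b = 1).card +
      2 * (Finset.univ.filter fun b => halfDegree s t b = 0).card + 2 * Fintype.card V ≤
      2 * Fintype.card I := by
  set S : I ⊕ Q → V ⊕ B := Sum.elim (Sum.inl ∘ x) (Sum.inr ∘ s) with hS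
  set R : I ⊕ Q → V ⊕ B := Sum.elim (Sum.inr ∘ y) (Sum.inr ∘ t) with hR
  -- `A` is good when the edges of `A` and `Q` alone already bypass every edge of `Q`. A minimal
  -- good set has no dangling edge, which bounds the degrees below.
  let good : Finset I → Prop := fun A => ∀ e₀ : Q,
    joined S R {f | f ≠ Sum.inr e₀ ∧ ∀ i, f = Sum.inl i → i ∈ A} (Sum.inr (s e₀)) (Sum.inr (t e₀))
  have hgood : good Finset.univ := by
    intro e₀
    refine joined_mono ?_ (h e₀ _ _)
    intro f hf
    exact ⟨hf, by simp⟩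
  obtain ⟨A, -, hA⟩ := (Set.toFinite {A | good A}).exists_le_minimal hgood
  have hAg : good A := hA.prop
  have hmin : ∀ i ∈ A, ¬ good (A.erase i) := by
    intro i hi hg
    have := hA.le_of_le hg (Finset.erase_subset i A)
    exact Finset.notMem_erase i A (this hi)
  -- the degrees in `A`
  let dV : V → ℕ := fun v => (A.filter fun i => x i = v).card
  let dB : B → ℕ := fun b => (A.filter fun i => y i = b).card
  have sumV : ∑ v, dV v = A.card :=
    (Finset.card_eq_sum_card_fiberwise (f := x) (t := Finset.univ) (by simp)).symm
  have sumB : ∑ b, dB b = A.card :=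
    (Finset.card_eq_sum_card_fiberwise (f := y) (t := Finset.univ) (by simp)).symm
  -- A vertex touched by no edge of `Q` and by a single edge of `A` is a dead end; that edge could
  -- be dropped, against minimality.
  have pend : ∀ (i : I), i ∈ A → ∀ a c : V ⊕ B,
      (S (Sum.inl i) = a ∧ R (Sum.inl i) = c ∨ S (Sum.inl i) = c ∧ R (Sum.inl i) = a) →
      (∀ i' ∈ A, i' ≠ i → S (Sum.inl i') ≠ a ∧ R (Sum.inl i') ≠ a) →
      (∀ e : Q, Sum.inr (s e) ≠ a ∧ Sum.inr (t e) ≠ a) → False := by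
    intro i hi a c hac h1 h2
    refine hmin i hi fun e₀ => ?_
    refine joined_mono ?_ (joined_diff_pendant hac ?_ (h2 e₀).1 (h2 e₀).2 (hAg e₀))
    · rintro f ⟨⟨hf1, hf2⟩, hf3⟩
      refine ⟨hf1, fun i' hi' => ?_⟩
      refine Finset.mem_erase.2 ⟨?_, hf2 i' hi'⟩
      rintro rfl
      exact hf3 hi'
    · rintro (i' | e) ⟨he1, he2⟩ hne
      · exact h1 i' (he2 i' rfl) (by rintro rfl; exact hne rfl)
      · exact h2 e
  have hdV : ∀ v, dV v ≠ 1 := by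
    intro v hv
    obtain ⟨i, hi⟩ := Finset.card_eq_one.1 hv
    have hiA : i ∈ A ∧ x i = v := by simpa using Finset.ext_iff.1 hi i
    refine pend i hiA.1 (Sum.inl v) (Sum.inr (y i)) (Or.inl ⟨by simp [S, hiA.2], by simp [R]⟩) ?_ ?_
    · intro i' hi' hne
      refine ⟨?_, by simp [R]⟩
      intro h'
      have : x i' = v := by simpa [S] using h'
      have h'' : i' ∈ A.filter fun i => x i = v := Finset.mem_filter.2 ⟨hi', this⟩
      rw [hi] at h''
      exact hne (Finset.mem_singleton.1 h'')
    · intro e; simp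
  have hdB0 : ∀ b, halfDegree s t b = 0 → dB b ≠ 1 := by
    intro b hb0 hb
    obtain ⟨i, hi⟩ := Finset.card_eq_one.1 hb
    have hiA : i ∈ A ∧ y i = b := by simpa using Finset.ext_iff.1 hi i
    refine pend i hiA.1 (Sum.inr b) (Sum.inl (x i)) (Or.inr ⟨by simp [S], by simp [R, hiA.2]⟩) ?_ ?_
    · intro i' hi' hne
      refine ⟨by simp [S], ?_⟩
      intro h'
      have : y i' = b := by simpa [R] using h'
      have h'' : i' ∈ A.filter fun i => y i = b := Finset.mem_filter.2 ⟨hi', this⟩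
      rw [hi] at h''
      exact hne (Finset.mem_singleton.1 h'')
    · intro e
      simp only [halfDegree, Nat.add_eq_zero_iff, Finset.card_eq_zero, Finset.filter_eq_empty_iff,
        Finset.mem_univ, true_imp_iff] at hb0
      simp only [ne_eq, Sum.inr.injEq]
      exact ⟨@hb0.1 e, @hb0.2 e⟩
  -- Without an edge of `A` at `b`, the only edge of `Q` at `b` could not be bypassed.
  have hdB1 : ∀ b, halfDegree s t b = 1 → dB b ≠ 0 := by
    intro b hb1 hb
    have hnoA : ∀ i ∈ A, y i ≠ b := by
      intro i hi h'
      have : i ∈ A.filter fun i => y i = b := Finset.mem_filter.2 ⟨hi, h'⟩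
      rw [Finset.card_eq_zero.1 hb] at this
      simp at this
    have : ∃ e, (s e = b ∧ t e ≠ b ∨ s e ≠ b ∧ t e = b) ∧ ∀ e', e' ≠ e → s e' ≠ b ∧ t e' ≠ b := by
      unfold halfDegree at hb1
      rcases Nat.add_eq_one_iff.1 hb1 with ⟨h0, h1⟩ | ⟨h1, h0⟩
      · obtain ⟨e, he⟩ := Finset.card_eq_one.1 h1
        have h0' := Finset.filter_eq_empty_iff.1 (Finset.card_eq_zero.1 h0)
        have he' : ∀ e', t e' = b ↔ e' = e := by simpa using Finset.ext_iff.1 he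
        refine ⟨e, Or.inr ⟨h0' (Finset.mem_univ e), (he' e).2 rfl⟩, fun e' hne => ⟨h0' (Finset.mem_univ e'), fun h => hne ((he' e').1 h)⟩⟩
      · obtain ⟨e, he⟩ := Finset.card_eq_one.1 h1
        have h0' := Finset.filter_eq_empty_iff.1 (Finset.card_eq_zero.1 h0)
        have he' : ∀ e', s e' = b ↔ e' = e := by simpa using Finset.ext_iff.1 he
        refine ⟨e, Or.inl ⟨(he' e).2 rfl, h0' (Finset.mem_univ e)⟩, fun e' hne => ⟨fun h => hne ((he' e').1 h), h0' (Finset.mem_univ e')⟩⟩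
    obtain ⟨e, he, huniq⟩ := this
    have := eq_of_joined (fun z => decide (z = Sum.inr b)) ?_ (hAg e)
    · rcases he with ⟨h1, h2⟩ | ⟨h1, h2⟩ <;> simp [h1, h2] at this
    · rintro (i | e') ⟨hf1, hf2⟩
      · simp [S, R, hnoA i (hf2 i rfl)]
      · have := huniq e' (by rintro rfl; exact hf1 rfl)
        simp [S, R, this.1, this.2]
  -- vertices incident to an edge in `A` or `Q`
  let U : Finset (V ⊕ B) := ((Finset.univ.filter fun v => dV v ≠ 0).disjSum
    (Finset.univ.filter fun b => ¬ (dB b = 0 ∧ halfDegree s t b = 0)))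
  have hU := card_add_card_le_of_connected (s := S) (t := R)
    (fun a b => joined_mono (Set.subset_univ _) (h (Classical.arbitrary Q) a b))
    (A.disjSum Finset.univ) ⟨Sum.inr (Classical.arbitrary Q), by simp⟩ U ?_
  · have e1 : 2 * (Finset.univ.filter fun v => dV v ≠ 0).card ≤ A.card := by
      rw [← sumV, mul_comm, ← smul_eq_mul]
      refine (Finset.card_nsmul_le_sum _ dV 2 ?_).trans
        (Finset.sum_le_sum_of_subset (Finset.subset_univ _))
      intro v hv
      have h1 := hdV v
      have h2 := (Finset.mem_filter.1 hv).2
      omega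
    -- This holds vertex by vertex: at half-degree one `dB b` is at least one, and at half-degree
    -- zero it is either zero or at least two.
    have e2 : (Finset.univ.filter fun b => halfDegree s t b = 1).card +
        2 * (Finset.univ.filter fun b => halfDegree s t b = 0).card +
        2 * (Finset.univ.filter fun b => ¬ (dB b = 0 ∧ halfDegree s t b = 0)).card ≤
        A.card + 2 * Fintype.card B := by
      rw [← sumB]
      have cB : 2 * Fintype.card B = ∑ _b : B, 2 := by simp [mul_comm]
      simp only [cB, Finset.card_filter, Finset.mul_sum, ← Finset.sum_add_distrib]
      refine Finset.sum_le_sum fun b _ => ?_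
      have h0 := hdB0 b
      have h1 := hdB1 b
      split_ifs <;> omega
    simp only [U, Finset.card_disjSum, Finset.card_univ, Fintype.card_sum] at hU
    omega
  · rintro (v | b) hw (i | e) he
    · have hi : i ∈ A := by simpa using he
      have hv : dV v = 0 := by simpa [U] using hw
      have := Finset.filter_eq_empty_iff.1 (Finset.card_eq_zero.1 hv) hi
      simpa [S, R] using this
    · simp [S, R]
    · have hi : i ∈ A := by simpa using he
      have hv : dB b = 0 ∧ halfDegree s t b = 0 := by
        simpa only [U, Finset.inr_mem_disjSum, Finset.mem_filter, Finset.mem_univ, true_and,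
          not_not] using hw
      have := Finset.filter_eq_empty_iff.1 (Finset.card_eq_zero.1 hv.1) hi
      simpa [S, R] using this
    · have hv : dB b = 0 ∧ halfDegree s t b = 0 := by
        simpa only [U, Finset.inr_mem_disjSum, Finset.mem_filter, Finset.mem_univ, true_and,
          not_not] using hw
      have hb0 := hv.2
      simp only [halfDegree, Nat.add_eq_zero_iff, Finset.card_eq_zero, Finset.filter_eq_empty_iff,
        Finset.mem_univ, true_imp_iff] at hb0
      simp only [S, R, Sum.elim_inr, Function.comp, ne_eq, Sum.inr.injEq]
      exact ⟨@hb0.1 e, @hb0.2 e⟩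

end Counting

noncomputable instance fintypeQuotient {V : Type} [Finite V] (r : Setoid V) :
    Fintype (Quotient r) := Fintype.ofFinite _

/-! ### Walks as lists of edges -/

section Walks

variable {W F : Type*}

/-- `l` is the list of edges of a walk from `v` to `w`. -/
def IsWalk (s t : F → W) : W → List F → W → Prop
  | v, [], w => v = w
  | v, e :: l, w => s e = v ∧ IsWalk s t (t e) l w

variable {s t : F → W}

theorem IsWalk.filter {p : F → Bool} (hp : ∀ e, p e = false → s e = t e) {v w : W} {l : List F}
    (h : IsWalk s t v l w) : IsWalk s t v (l.filter p) w := by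
  induction l generalizing v with
  | nil => exact h
  | cons e l ih =>
    obtain ⟨rfl, h⟩ := h
    cases he : p e with
    | true => rw [List.filter_cons_of_pos he]; exact ⟨rfl, ih h⟩
    | false =>
      rw [List.filter_cons_of_neg (by simp [he]), hp e he]
      exact ih h

theorem IsWalk.comp {X : Type*} (q : W → X) {v w : W} {l : List F} (h : IsWalk s t v l w) :
    IsWalk (q ∘ s) (q ∘ t) (q v) l (q w) := by
  induction l generalizing v with
  | nil => exact congrArg q h
  | cons e l ih =>
    obtain ⟨rfl, h⟩ := h
    exact ⟨rfl, ih h⟩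

theorem isWalk_map {F' : Type*} (g : F' → F) {v w : W} {l : List F'} :
    IsWalk s t v (l.map g) w ↔ IsWalk (s ∘ g) (t ∘ g) v l w := by
  induction l generalizing v with
  | nil => rfl
  | cons e l ih => exact and_congr Iff.rfl ih

theorem IsWalk.of_comp_injective {X : Type*} {q : W → X} (hq : Function.Injective q) {v w : W}
    {l : List F} (h : IsWalk (q ∘ s) (q ∘ t) (q v) l (q w)) : IsWalk s t v l w := by
  induction l generalizing v with
  | nil => exact hq h
  | cons e l ih => exact ⟨hq h.1, ih h.2⟩

theorem isWalk_of_seq (l : List F) (x : ℕ → W)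
    (h : ∀ i (hi : i < l.length), s l[i] = x i ∧ t l[i] = x (i + 1)) :
    IsWalk s t (x 0) l (x l.length) := by
  induction l generalizing x with
  | nil => rfl
  | cons e l ih =>
    refine ⟨(h 0 (by simp)).1, ?_⟩
    have h0 : t e = x 1 := (h 0 (by simp)).2
    rw [h0]
    exact ih (fun i => x (i + 1)) fun i hi => h (i + 1) (Nat.succ_lt_succ hi)

theorem IsWalk.exists_seq {v w : W} {l : List F} (h : IsWalk s t v l w) :
    ∃ x : ℕ → W, x 0 = v ∧ x l.length = w ∧
      ∀ i (hi : i < l.length), s l[i] = x i ∧ t l[i] = x (i + 1) := by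
  induction l generalizing v with
  | nil => exact ⟨fun _ => v, rfl, h, by simp⟩
  | cons e l ih =>
    obtain ⟨x, h0, h1, h2⟩ := ih h.2
    refine ⟨fun i => Nat.casesOn i v x, rfl, h1, ?_⟩
    intro i hi
    cases i with
    | zero => exact ⟨h.1, h0.symm⟩
    | succ i => simpa using h2 i (by simpa using hi)

end Walks

/-! ### Cyclic graphs, their quotients and connected pieces -/

namespace StarGraph

variable {L : Type u}

theorem isCyclic_iff_exists_fin (T : StarGraph L) :
    T.IsCyclic ↔ T.IsTest ∧ ∃ (n : ℕ) (c : Fin n ≃ T.E),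
      ∀ k, T.tgt (c k) = T.src (c (finRotate _ k)) := by
  refine and_congr Iff.rfl ⟨fun ⟨c, hc⟩ => ⟨_, c, hc⟩, ?_⟩
  rintro ⟨n, c, hc⟩
  obtain rfl : Fintype.card T.E = n := by simpa using (Fintype.card_congr c).symm
  exact ⟨c, hc⟩

theorem isCyclic_of_equiv {L' : Type*} {T : StarGraph L} {T' : StarGraph L'} (eV : T.V ≃ T'.V)
    (eE : T.E ≃ T'.E) (hs : ∀ e, eV (T.src e) = T'.src (eE e))
    (ht : ∀ e, eV (T.tgt e) = T'.tgt (eE e)) (h : T.IsCyclic) : T'.IsCyclic := by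
  rw [isCyclic_iff_exists_fin] at h ⊢
  obtain ⟨⟨hne, hconn⟩, n, c, hc⟩ := h
  refine ⟨⟨hne.map eV, fun v w => ?_⟩, n, c.trans eE, fun k => ?_⟩
  · have := joined_le (s := T.src) (t := T.tgt) (S := Set.univ)
      (r := Setoid.comap eV (T'.joinedBy Set.univ)) ?_ (hconn (eV.symm v) (eV.symm w))
    · simpa [Setoid.comap_rel] using this
    · intro e _
      rw [Setoid.comap_rel, hs, ht]
      exact joined_edge (s := T'.src) (t := T'.tgt) (Set.mem_univ _)
  · simp only [Equiv.trans_apply, ← hs, ← ht, hc]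

/-- The image of `T` by a map defined on its vertices. -/
def push (T : StarGraph L) {W : Type} [Fintype W] (f : T.V → W) : StarGraph L where
  V := W
  E := T.E
  src e := f (T.src e)
  tgt e := f (T.tgt e)
  γ := T.γ
  ε := T.ε

theorem IsCyclic.push {T : StarGraph L} (h : T.IsCyclic) {W : Type} [Fintype W] {f : T.V → W}
    (hf : Function.Surjective f) : (T.push f).IsCyclic := by
  obtain ⟨⟨hne, hconn⟩, c, hc⟩ := h
  refine ⟨⟨hne.map f, fun v w => ?_⟩, c, fun k => congrArg f (hc k)⟩
  obtain ⟨v, rfl⟩ := hf v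
  obtain ⟨w, rfl⟩ := hf w
  exact joined_le (s := T.src) (t := T.tgt) (S := Set.univ)
    (r := Setoid.comap f ((T.push f).joinedBy Set.univ))
    (fun e _ => joined_edge (s := (T.push f).src) (t := (T.push f).tgt) (Set.mem_univ e))
    (hconn v w)

theorem IsCyclic.quot {T : StarGraph L} (h : T.IsCyclic) (π : Setoid T.V) : (T.quot π).IsCyclic :=
  h.push Quotient.mk_surjective

/-- A closed walk enters each vertex as often as it leaves it: the rotation carries targets to
sources. -/
theorem IsCyclic.sum_tgt {T : StarGraph L} (h : T.IsCyclic) (g : T.V → ℤ) :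
    ∑ e, g (T.tgt e) = ∑ e, g (T.src e) := by
  obtain ⟨-, c, hc⟩ := h
  rw [← Equiv.sum_comp c, ← Equiv.sum_comp c (fun e => g (T.src e)),
    ← Equiv.sum_comp (finRotate _) (fun k => g (T.src (c k)))]
  exact Finset.sum_congr rfl fun k _ => congrArg g (hc k)

theorem joinedBy_compl_of_ends {T : StarGraph L} (hT : T.IsTest) {e : T.E}
    (h : T.joinedBy {e}ᶜ (T.src e) (T.tgt e)) (v w : T.V) : T.joinedBy {e}ᶜ v w := by
  refine joined_le (s := T.src) (t := T.tgt) (S := Set.univ) ?_ (hT.2 v w)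
  intro e' _
  by_cases he : e' = e
  · subst he; exact h
  · exact joined_edge (s := T.src) (t := T.tgt) he

/-- A cyclic graph has no bridge. Apply the balance of sources and targets to the indicator of the
part reached from `T.src e` without `e`: every other edge contributes the same on both sides, so `e`
must too, and its target lies in that part. -/
theorem IsCyclic.joinedBy_compl {T : StarGraph L} (h : T.IsCyclic) (e : T.E) (v w : T.V) :
    T.joinedBy {e}ᶜ v w := by
  classical
  refine joinedBy_compl_of_ends h.1 ?_ v w
  let g : T.V → ℤ := fun v => if T.joinedBy {e}ᶜ (T.src e) v then 1 else 0
  have hg : ∀ e' ∈ Finset.univ.erase e, g (T.tgt e') = g (T.src e') := by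
    intro e' he'
    have hj : T.joinedBy {e}ᶜ (T.src e') (T.tgt e') :=
      joined_edge (s := T.src) (t := T.tgt) (Finset.ne_of_mem_erase he')
    have : T.joinedBy {e}ᶜ (T.src e) (T.tgt e') ↔ T.joinedBy {e}ᶜ (T.src e) (T.src e') :=
      ⟨fun h => Setoid.trans' _ h (Setoid.symm' _ hj), fun h => Setoid.trans' _ h hj⟩
    simp only [g, this]
  have hsum := h.sum_tgt g
  rw [← Finset.add_sum_erase _ _ (Finset.mem_univ e), ← Finset.add_sum_erase _ (fun e => g (T.src e))
    (Finset.mem_univ e), Finset.sum_congr rfl hg] at hsum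
  have h1 : g (T.tgt e) = g (T.src e) := add_right_cancel hsum
  have h2 : g (T.src e) = 1 := if_pos (Setoid.refl' _ _)
  rw [h2] at h1
  by_contra hcon
  simp [g, hcon] at h1

/-- The subgraph of `T` on a block of a partition whose blocks are not separated by edges. -/
noncomputable def piece (T : StarGraph L) (r : Setoid T.V) (h : ∀ e, r (T.src e) (T.tgt e))
    (K : Quotient r) : StarGraph L where
  V := {v : T.V // Quotient.mk r v = K}
  E := {e : T.E // Quotient.mk r (T.src e) = K}
  fintypeV := Fintype.ofFinite _
  fintypeE := Fintype.ofFinite _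
  src e := ⟨T.src e.1, e.2⟩
  tgt e := ⟨T.tgt e.1, (Quotient.sound (r.symm (h e.1))).trans e.2⟩
  γ e := T.γ e.1
  ε e := T.ε e.1

/-- No edge leaves a block, so a path of `T` between two vertices of a block stays in it. The
relation `r'` carries both facts along the path. -/
theorem piece_isTest (T : StarGraph L) (r : Setoid T.V) (h : ∀ e, r (T.src e) (T.tgt e))
    (hr : r ≤ T.joinedBy Set.univ) (K : Quotient r) : (T.piece r h K).IsTest := by
  refine ⟨?_, ?_⟩
  · obtain ⟨v, hv⟩ := Quotient.exists_rep K
    exact ⟨⟨v, hv⟩⟩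
  · rintro ⟨v, hv⟩ ⟨w, hw⟩
    let r' : Setoid T.V :=
      { r := fun a b => r a b ∧ ∀ (ha : Quotient.mk r a = K) (hb : Quotient.mk r b = K),
          (T.piece r h K).joinedBy Set.univ ⟨a, ha⟩ ⟨b, hb⟩
        iseqv :=
          { refl := fun a => ⟨r.refl a, fun _ _ => Setoid.refl' _ _⟩
            symm := fun h => ⟨r.symm h.1, fun ha hb => Setoid.symm' _ (h.2 hb ha)⟩
            trans := fun {a b c} h1 h2 => ⟨r.trans h1.1 h2.1, fun ha hc =>
              have hb := (Quotient.sound (r.symm h1.1)).trans ha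
              Setoid.trans' _ (h1.2 ha hb) (h2.2 hb hc)⟩ } }
    have : T.joinedBy Set.univ ≤ r' := by
      refine joined_le (s := T.src) (t := T.tgt) fun e _ => ⟨h e, fun ha hb => ?_⟩
      exact joined_edge (s := (T.piece r h K).src) (t := (T.piece r h K).tgt)
        (Set.mem_univ (⟨e, ha⟩ : {e : T.E // Quotient.mk r (T.src e) = K}))
    exact (this (hr (Quotient.exact (hv.trans hw.symm)))).2 hv hw

/-- The connected components of a graph. -/
abbrev Comps (T : StarGraph L) : Type := Quotient (T.joinedBy Set.univ)

theorem joinedBy_univ_edge (T : StarGraph L) (e : T.E) :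
    T.joinedBy Set.univ (T.src e) (T.tgt e) :=
  joined_edge (s := T.src) (t := T.tgt) (Set.mem_univ e)

/-- A connected component, as a graph. -/
noncomputable abbrev conn (T : StarGraph L) (K : T.Comps) : StarGraph L :=
  T.piece _ T.joinedBy_univ_edge K

theorem conn_isTest (T : StarGraph L) (K : T.Comps) : (T.conn K).IsTest :=
  T.piece_isTest _ _ le_rfl K

/-! ### Leaves -/

theorem IsCutting.not_joinedBy {T : StarGraph L} (hT : T.IsTest) {e : T.E} (he : T.IsCutting e) :
    ¬ T.joinedBy {e}ᶜ (T.src e) (T.tgt e) :=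
  fun h => he (joinedBy_compl_of_ends hT h)

theorem joinedBy_compl_of_twoEdgeComp {T : StarGraph L} {e : T.E} (he : T.IsCutting e) {v w : T.V}
    (h : (Quotient.mk _ v : T.TwoEdgeComp) = Quotient.mk _ w) : T.joinedBy {e}ᶜ v w :=
  joined_mono (s := T.src) (t := T.tgt)
    (fun e' (he' : ¬ T.IsCutting e') => by rintro rfl; exact he' he) (Quotient.exact h)

/-- The source of a cutting edge in the tree of two-edge connected components. -/
def cutSrc (T : StarGraph L) (e : {e // T.IsCutting e}) : T.TwoEdgeComp := Quotient.mk _ (T.src e.1)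

/-- The target of a cutting edge in the tree of two-edge connected components. -/
def cutTgt (T : StarGraph L) (e : {e // T.IsCutting e}) : T.TwoEdgeComp := Quotient.mk _ (T.tgt e.1)

theorem cutSrc_ne_cutTgt {T : StarGraph L} (hT : T.IsTest) (e : {e // T.IsCutting e}) :
    T.cutSrc e ≠ T.cutTgt e :=
  fun h => e.2.not_joinedBy hT (joinedBy_compl_of_twoEdgeComp e.2 h)

/-- Two cutting edges between the same two-edge components would bypass each other. -/
theorem cut_unique {T : StarGraph L} (hT : T.IsTest) {e f : {e // T.IsCutting e}}
    (h : T.cutSrc e = T.cutSrc f ∧ T.cutTgt e = T.cutTgt f ∨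
      T.cutSrc e = T.cutTgt f ∧ T.cutTgt e = T.cutSrc f) : e = f := by
  by_contra hne
  refine f.2.not_joinedBy hT ?_
  have he : T.joinedBy {f.1}ᶜ (T.src e.1) (T.tgt e.1) :=
    joined_edge (s := T.src) (t := T.tgt) (fun h => hne (Subtype.ext h))
  rcases h with ⟨h1, h2⟩ | ⟨h1, h2⟩
  · exact Setoid.trans' _ (joinedBy_compl_of_twoEdgeComp f.2 h1.symm)
      (Setoid.trans' _ he (joinedBy_compl_of_twoEdgeComp f.2 h2))
  · exact Setoid.trans' _ (joinedBy_compl_of_twoEdgeComp f.2 h2.symm)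
      (Setoid.trans' _ (Setoid.symm' _ he) (joinedBy_compl_of_twoEdgeComp f.2 h1))

noncomputable instance (T : StarGraph L) : Fintype {e // T.IsCutting e} := Fintype.ofFinite _

open Classical in
-- The simple graph `compTree` forgets multiplicities, but `cut_unique` says that there are none,
-- and there are no loops either.
theorem halfDegree_of_leaf {T : StarGraph L} (hT : T.IsTest) {C : T.TwoEdgeComp}
    (h : ∃! D, T.compTree.Adj C D) : halfDegree T.cutSrc T.cutTgt C = 1 := by
  obtain ⟨D, hD, huniq⟩ := h
  have adj : ∀ e : {e // T.IsCutting e}, T.compTree.Adj (T.cutSrc e) (T.cutTgt e) := fun e => by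
    rw [compTree, SimpleGraph.fromRel_adj]
    exact ⟨cutSrc_ne_cutTgt hT e, Or.inl ⟨e.1, e.2, rfl, rfl⟩⟩
  have hs : ∀ e, T.cutSrc e = C → T.cutTgt e = D := fun e he => huniq _ (he ▸ adj e)
  have ht : ∀ e, T.cutTgt e = C → T.cutSrc e = D := fun e he => huniq _ (he ▸ (adj e).symm)
  rw [compTree, SimpleGraph.fromRel_adj] at hD
  obtain ⟨hCD, ⟨e, he, h1, h2⟩ | ⟨e, he, h1, h2⟩⟩ := hD
  · have h1' : T.cutSrc ⟨e, he⟩ = C := h1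
    have h2' : T.cutTgt ⟨e, he⟩ = D := h2
    have e1 : (Finset.univ.filter fun e => T.cutSrc e = C) = {⟨e, he⟩} := by
      ext f
      simp only [Finset.mem_filter, Finset.mem_univ, true_and, Finset.mem_singleton]
      exact ⟨fun hf => cut_unique hT (Or.inl ⟨hf.trans h1'.symm, (hs f hf).trans h2'.symm⟩),
        fun hf => hf ▸ h1'⟩
    have e2 : (Finset.univ.filter fun e => T.cutTgt e = C) = ∅ := by
      refine Finset.filter_eq_empty_iff.2 fun f _ hf => ?_
      have := cut_unique hT (f := ⟨e, he⟩) (Or.inr ⟨(ht f hf).trans h2'.symm, hf.trans h1'.symm⟩)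
      subst this
      exact hCD (hf.symm.trans h2')
    rw [halfDegree_eq, e1, e2]; simp
  · have h1' : T.cutSrc ⟨e, he⟩ = D := h1
    have h2' : T.cutTgt ⟨e, he⟩ = C := h2
    have e1 : (Finset.univ.filter fun e => T.cutTgt e = C) = {⟨e, he⟩} := by
      ext f
      simp only [Finset.mem_filter, Finset.mem_univ, true_and, Finset.mem_singleton]
      exact ⟨fun hf => cut_unique hT (Or.inl ⟨(ht f hf).trans h1'.symm, hf.trans h2'.symm⟩),
        fun hf => hf ▸ h2'⟩
    have e2 : (Finset.univ.filter fun e => T.cutSrc e = C) = ∅ := by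
      refine Finset.filter_eq_empty_iff.2 fun f _ hf => ?_
      have := cut_unique hT (f := ⟨e, he⟩) (Or.inr ⟨hf.trans h2'.symm, (hs f hf).trans h1'.symm⟩)
      subst this
      exact hCD (hf.symm.trans h1')
    rw [halfDegree_eq, e1, e2]; simp

open Classical in
-- The convention of two leaves for the trivial tree is absorbed by counting twice a vertex of
-- half-degree zero. This is the form in which `leaf_count` bounds leaves.
theorem numLeaves_le {T : StarGraph L} (hT : T.IsTest) :
    T.numLeaves ≤ (Finset.univ.filter fun b => halfDegree T.cutSrc T.cutTgt b = 1).card +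
      2 * (Finset.univ.filter fun b => halfDegree T.cutSrc T.cutTgt b = 0).card := by
  unfold numLeaves
  split_ifs with h
  · have hcut : ∀ e : {e // T.IsCutting e}, False := fun e =>
      cutSrc_ne_cutTgt hT e (Subsingleton.elim _ _)
    obtain ⟨v⟩ := hT.1
    have : 0 < (Finset.univ.filter fun b => halfDegree T.cutSrc T.cutTgt b = 0).card := by
      refine Finset.card_pos.2 ⟨Quotient.mk _ v, Finset.mem_filter.2 ⟨Finset.mem_univ _, ?_⟩⟩
      rw [halfDegree_eq, Finset.filter_eq_empty_iff.2 fun e _ => (hcut e).elim,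
        Finset.filter_eq_empty_iff.2 fun e _ => (hcut e).elim]
      rfl
    omega
  · refine le_add_right ?_
    rw [Nat.card_eq_fintype_card, Fintype.card_subtype]
    refine Finset.card_le_card fun C hC => ?_
    simp only [Finset.mem_filter, Finset.mem_univ, true_and] at hC ⊢
    exact halfDegree_of_leaf hT hC

theorem numLeaves_of_forall_not_isCutting {T : StarGraph L} (hT : T.IsTest)
    (h : ∀ e, ¬ T.IsCutting e) : T.numLeaves = 2 := by
  have : Subsingleton T.TwoEdgeComp := by
    constructor
    intro x y
    induction x using Quotient.inductionOn
    induction y using Quotient.inductionOn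
    exact Quotient.sound (joined_mono (s := T.src) (t := T.tgt) (fun e _ => h e) (hT.2 _ _))
  rw [numLeaves, if_pos this]

theorem IsCyclic.numLeaves {T : StarGraph L} (h : T.IsCyclic) : T.numLeaves = 2 :=
  numLeaves_of_forall_not_isCutting h.1 fun e he => he (h.joinedBy_compl e)

end StarGraph

open Classical in
theorem halfDegree_sigma {κ : Type} [Fintype κ] {B Q : κ → Type} [∀ k, Fintype (B k)]
    [∀ k, Fintype (Q k)] (s t : ∀ k, Q k → B k) (k : κ) (b : B k) :
    halfDegree (Sigma.map id s) (Sigma.map id t) ⟨k, b⟩ = halfDegree (s k) (t k) b := by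
  have key : ∀ u : ∀ k, Q k → B k,
      (Finset.univ.filter fun e : Σ k, Q k => Sigma.map id u e = ⟨k, b⟩) =
        (Finset.univ.filter fun e => u k e = b).map (Function.Embedding.sigmaMk k) := by
    intro u
    ext ⟨k', e⟩
    rw [Finset.mem_filter, Finset.mem_map]
    simp only [Finset.mem_filter, Finset.mem_univ, true_and,
      Function.Embedding.sigmaMk_apply, Sigma.map, id]
    constructor
    · intro h
      obtain rfl : k' = k := congrArg Sigma.fst h
      exact ⟨e, eq_of_heq (Sigma.mk.inj h).2, rfl⟩
    · rintro ⟨e', rfl, h⟩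
      obtain rfl : k = k' := congrArg Sigma.fst h
      obtain rfl := eq_of_heq (Sigma.mk.inj h).2
      rfl
  rw [halfDegree_eq, halfDegree_eq, key, key, Finset.card_map, Finset.card_map]

/-! ### Subgraphs of one colour -/

namespace StarGraph

variable {p : ℕ} {ι : Fin p → Type u}

/-- The graph of the edges labelled in the `j`-th family, on all the vertices. -/
noncomputable def restrict (T : StarGraph (Σ j, ι j)) (j : Fin p) : StarGraph (ι j) where
  V := T.V
  E := {e : T.E // (T.γ e).1 = j}
  fintypeE := Fintype.ofFinite _
  src e := T.src e.1
  tgt e := T.tgt e.1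
  γ e := e.2 ▸ (T.γ e.1).2
  ε e := T.ε e.1

theorem joinedBy_restrict (T : StarGraph (Σ j, ι j)) (j : Fin p) :
    (T.restrict j).joinedBy Set.univ = T.joinedIn j := by
  refine le_antisymm ?_ ?_
  · exact joined_le (s := (T.restrict j).src) (t := (T.restrict j).tgt)
      fun e _ => joined_edge (s := T.src) (t := T.tgt) e.2
  · exact joined_le (s := T.src) (t := T.tgt) fun e he =>
      joined_edge (s := (T.restrict j).src) (t := (T.restrict j).tgt)
        (Set.mem_univ (⟨e, he⟩ : {e : T.E // (T.γ e).1 = j}))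

theorem joinedIn_edge (T : StarGraph (Σ j, ι j)) (j : Fin p) (e : (T.restrict j).E) :
    T.joinedIn j ((T.restrict j).src e) ((T.restrict j).tgt e) :=
  joined_edge (s := T.src) (t := T.tgt) e.2

/-- The component `K` of the graph of the edges labelled in the `j`-th family. It may be an
isolated vertex. -/
noncomputable abbrev colorPiece (T : StarGraph (Σ j, ι j)) (j : Fin p)
    (K : Quotient (T.joinedIn j)) : StarGraph (ι j) :=
  (T.restrict j).piece _ (T.joinedIn_edge j) K

theorem colorPiece_isTest (T : StarGraph (Σ j, ι j)) (j : Fin p) (K : Quotient (T.joinedIn j)) :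
    (T.colorPiece j K).IsTest :=
  piece_isTest _ _ _ (T.joinedBy_restrict j).ge K

/-! ### The exponents of growth -/

section Exponent

variable (T : StarGraph (Σ j, ι j)) {W : Fin p → Type} [∀ j, Fintype (W j)] (f : ∀ j, T.V → W j)

/-- The graphs obtained by mapping the subgraph of each color to some set of vertices. -/
noncomputable abbrev colorPush (j : Fin p) : StarGraph (ι j) := (T.restrict j).push (f j)

/-- If there are not too many components, the exponents of growth are controlled. -/
theorem sum_numLeaves_le (hT : T.IsCyclic) (hf : ∀ j, Function.Surjective (f j))
    (hcard : ∑ j, Fintype.card (T.colorPush f j).Comps + Fintype.card T.V ≤ p * Fintype.card T.V) :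
    ∑ j, ∑ K : (T.colorPush f j).Comps, ((T.colorPush f j).conn K).numLeaves +
      2 * Fintype.card T.V ≤ 2 * (p * Fintype.card T.V) := by
  classical
  let G : (Σ j, (T.colorPush f j).Comps) → (Σ j, StarGraph (ι j)) :=
    fun x => ⟨x.1, (T.colorPush f x.1).conn x.2⟩
  have hG : ∀ x, (G x).2.IsTest := fun x => conn_isTest _ _
  rw [← Fintype.sum_sigma' (fun j K => ((T.colorPush f j).conn K).numLeaves)]
  change ∑ x, (G x).2.numLeaves + _ ≤ _
  -- Without cutting edges every piece has two leaves and the claim is `hcard`. With at least one,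
  -- `leaf_count` applies and `hcard` plays no role.
  by_cases hcut : ∀ (x) (e : (G x).2.E), ¬ (G x).2.IsCutting e
  · have : ∀ x, (G x).2.numLeaves = 2 := fun x => numLeaves_of_forall_not_isCutting (hG x) (hcut x)
    simp only [this, Finset.sum_const, Finset.card_univ, Fintype.card_sigma, smul_eq_mul]
    omega
  · push Not at hcut
    obtain ⟨x₀, e₀, he₀⟩ := hcut
    let B : Type := Σ x, (G x).2.TwoEdgeComp
    let Q : Type := Σ x, {e // (G x).2.IsCutting e}
    let s : Q → B := Sigma.map id fun x => (G x).2.cutSrc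
    let t : Q → B := Sigma.map id fun x => (G x).2.cutTgt
    let node : ∀ j, W j → B := fun j w =>
      ⟨⟨j, Quotient.mk _ w⟩, Quotient.mk _ (⟨w, rfl⟩ :
        {v : W j // Quotient.mk ((T.colorPush f j).joinedBy Set.univ) v = Quotient.mk _ w})⟩
    have hnode : ∀ (j) (w : W j) (K : (T.colorPush f j).Comps) (h : Quotient.mk _ w = K),
        node j w = ⟨⟨j, K⟩, Quotient.mk _ (⟨w, h⟩ :
        {v : W j // Quotient.mk ((T.colorPush f j).joinedBy Set.univ) v = K})⟩ := by
      intro j w K h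
      subst h
      rfl
    have : Nonempty Q := ⟨⟨x₀, e₀, he₀⟩⟩
    -- The graph has the vertices of `T` on one side and the two-edge components of all pieces of
    -- all colours on the other. Its edges are the cutting edges and one link per vertex and colour.
    have key := leaf_count (V := T.V) (I := T.V × Fin p) Prod.fst
      (fun i => node i.2 (f i.2 i.1)) s t ?_
    · rw [Fintype.card_prod, Fintype.card_fin, mul_comm (Fintype.card T.V)] at key
      refine le_trans (Nat.add_le_add_right ?_ _) key
      have h1 : ∀ m, (Finset.univ.filter fun b : B => halfDegree s t b = m).card =
          ∑ x, (Finset.univ.filter fun b =>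
            halfDegree (G x).2.cutSrc (G x).2.cutTgt b = m).card := by
        intro m
        simp only [Finset.card_filter]
        rw [Fintype.sum_sigma]
        refine Finset.sum_congr rfl fun x _ => Finset.sum_congr rfl fun b _ => ?_
        rw [halfDegree_sigma]
      rw [h1, h1, Finset.mul_sum, ← Finset.sum_add_distrib]
      exact Finset.sum_le_sum fun x _ => numLeaves_le (hG x)
    · rintro ⟨⟨j₁, K₁⟩, ⟨e₁, he₁K⟩, he₁⟩
      set S : (T.V × Fin p) ⊕ Q → T.V ⊕ B := Sum.elim (Sum.inl ∘ Prod.fst) (Sum.inr ∘ s) with hS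
      set R : (T.V × Fin p) ⊕ Q → T.V ⊕ B :=
        Sum.elim (Sum.inr ∘ fun i => node i.2 (f i.2 i.1)) (Sum.inr ∘ t) with hR
      set A : Set ((T.V × Fin p) ⊕ Q) := {Sum.inr ⟨⟨j₁, K₁⟩, ⟨e₁, he₁K⟩, he₁⟩}ᶜ with hA
      have hVnode : ∀ v j, joined S R A (Sum.inl v) (Sum.inr (node j (f j v))) := fun v j =>
        joined_edge (s := S) (t := R) (e := Sum.inl (v, j)) (by simp [hA])
      have hedge : ∀ (j) (e : (T.colorPush f j).E), e.1 ≠ e₁.1 →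
          joined S R A (Sum.inr (node j (f j (T.src e.1)))) (Sum.inr (node j (f j (T.tgt e.1)))) := by
        intro j e hne
        set K : (T.colorPush f j).Comps := Quotient.mk _ (f j (T.src e.1)) with hK
        let e' : ((T.colorPush f j).conn K).E := ⟨e, rfl⟩
        have h1 : node j (f j (T.src e.1)) =
            ⟨⟨j, K⟩, Quotient.mk _ (((T.colorPush f j).conn K).src e')⟩ := hnode j _ K rfl
        have h2 : node j (f j (T.tgt e.1)) =
            ⟨⟨j, K⟩, Quotient.mk _ (((T.colorPush f j).conn K).tgt e')⟩ := hnode j _ K _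
        rw [h1, h2]
        -- A cutting edge other than `e₁` is still available; a non-cutting edge has both ends in
        -- the same two-edge component.
        by_cases hc : ((T.colorPush f j).conn K).IsCutting e'
        · refine joined_edge (s := S) (t := R) (e := Sum.inr ⟨⟨j, K⟩, e', hc⟩) ?_
          simp only [hA, Set.mem_compl_iff, Set.mem_singleton_iff, Sum.inr.injEq]
          intro h
          have hx : j = j₁ := congrArg (fun q : Q => q.1.1) h
          have he : ∀ q q' : Q, q = q' → (q.2.1.1.1 : T.E) = q'.2.1.1.1 := by
            rintro _ _ rfl; rfl
          exact hne (he _ _ h)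
        · have : (Quotient.mk _ (((T.colorPush f j).conn K).src e') :
              ((T.colorPush f j).conn K).TwoEdgeComp) =
              Quotient.mk _ (((T.colorPush f j).conn K).tgt e') :=
            Quotient.sound (joined_edge (s := ((T.colorPush f j).conn K).src)
              (t := ((T.colorPush f j).conn K).tgt) hc)
          rw [this]
      -- As `T` is cyclic, its vertices remain connected without `e₁`, and each remaining edge lifts
      -- to the large graph through the links of its colour.
      have hVV : ∀ v w, joined S R A (Sum.inl v) (Sum.inl w) := by
        intro v w
        refine joined_le (s := T.src) (t := T.tgt) (r := Setoid.comap Sum.inl (joined S R A)) ?_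
          (hT.joinedBy_compl e₁.1 v w)
        intro e he
        rw [Setoid.comap_rel]
        exact Setoid.trans' _ (hVnode _ (T.γ e).1)
          (Setoid.trans' _ (hedge (T.γ e).1 ⟨e, rfl⟩ he) (Setoid.symm' _ (hVnode _ (T.γ e).1)))
      have hall : ∀ a, ∃ v, joined S R A a (Sum.inl v) := by
        rintro (v | ⟨⟨j, K⟩, b⟩)
        · exact ⟨v, Setoid.refl' _ _⟩
        · induction b using Quotient.inductionOn with | _ w
          obtain ⟨w, hw⟩ := w
          obtain ⟨v, rfl⟩ := hf j w
          refine ⟨v, Setoid.symm' _ ?_⟩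
          have := hVnode v j
          rw [hnode j _ K hw] at this
          exact this
      intro a b
      obtain ⟨v, hv⟩ := hall a
      obtain ⟨w, hw⟩ := hall b
      exact Setoid.trans' _ hv (Setoid.trans' _ (hVV v w) (Setoid.symm' _ hw))

end Exponent

/-! ### Free products -/

section Free

variable {T : StarGraph (Σ j, ι j)}

/-- Counting form of the property of being a free product. -/
def TreeLike (T : StarGraph (Σ j, ι j)) : Prop :=
  ∑ j, Fintype.card (Quotient (T.joinedIn j)) + Fintype.card T.V = p * Fintype.card T.V + 1

open Classical in
-- A tree falls apart when an edge is removed. If `v ≠ w` in `K` were joined by a path using no edge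
-- of `K`, the link from `v` to `K` in the bipartite graph of vertices and classes could be replaced
-- by that path followed by the link from `w` to `K`.
theorem TreeLike.eq_of_joinedBy (h : T.TreeLike) (hT : T.IsTest) {j : Fin p}
    {K : Quotient (T.joinedIn j)} {v w : T.V} (hv : Quotient.mk _ v = K) (hw : Quotient.mk _ w = K)
    (hvw : T.joinedBy {e | ¬ ((T.γ e).1 = j ∧ Quotient.mk _ (T.src e) = K)} v w) : v = w := by
  by_contra hne
  let s : T.V × Fin p → T.V ⊕ (Σ j, Quotient (T.joinedIn j)) := fun i => Sum.inl i.1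
  let t : T.V × Fin p → T.V ⊕ (Σ j, Quotient (T.joinedIn j)) :=
    fun i => Sum.inr ⟨i.2, Quotient.mk _ i.1⟩
  let A : Set (T.V × Fin p) := {(v, j)}ᶜ
  have hj : ∀ v' j', (v', j') ≠ (v, j) →
      joined s t A (Sum.inl v') (Sum.inr ⟨j', Quotient.mk _ v'⟩) :=
    fun v' j' hn => joined_edge (s := s) (t := t) (e := (v', j')) hn
  have hvw' : joined s t A (Sum.inl v) (Sum.inl w) := by
    refine joined_le (s := T.src) (t := T.tgt) (r := Setoid.comap Sum.inl (joined s t A)) ?_ hvw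
    intro e he
    have hst := T.mk_tgt_eq e rfl
    rw [Setoid.comap_rel]
    refine Setoid.trans' _ (hj _ (T.γ e).1 ?_) (Setoid.symm' _ ?_)
    · rintro h
      refine he ⟨congrArg Prod.snd h, ?_⟩
      rw [show T.src e = v from congrArg Prod.fst h]
      exact hv
    · rw [← hst]
      refine hj _ (T.γ e).1 ?_
      intro h
      refine he ⟨congrArg Prod.snd h, ?_⟩
      have h2 : (T.γ e).1 = j := congrArg Prod.snd h
      rw [← T.mk_tgt_eq e h2, show T.tgt e = v from congrArg Prod.fst h]
      exact hv
  have hvK : joined s t A (Sum.inl v) (Sum.inr ⟨j, Quotient.mk _ v⟩) := by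
    have := hj w j (fun h => hne (congrArg Prod.fst h).symm)
    rw [hw, ← hv] at this
    exact Setoid.trans' _ hvw' this
  have hj' : ∀ v' j', joined s t A (Sum.inl v') (Sum.inr ⟨j', Quotient.mk _ v'⟩) := by
    intro v' j'
    by_cases h : (v', j') = (v, j)
    · obtain ⟨rfl, rfl⟩ := Prod.mk.inj h
      exact hvK
    · exact hj v' j' h
  have hVV : ∀ a b, joined s t A (Sum.inl a) (Sum.inl b) := by
    intro a b
    refine joined_le (s := T.src) (t := T.tgt) (r := Setoid.comap Sum.inl (joined s t A)) ?_
      (hT.2 a b)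
    intro e _
    have := hj' (T.tgt e) (T.γ e).1
    rw [T.mk_tgt_eq e rfl] at this
    rw [Setoid.comap_rel]
    exact Setoid.trans' _ (hj' (T.src e) (T.γ e).1) (Setoid.symm' _ this)
  have hsub : Subsingleton (Quotient (joined s t A)) := by
    have hall : ∀ a, joined s t A a (Sum.inl v) := by
      rintro (a | ⟨j', K'⟩)
      · exact hVV a v
      · induction K' using Quotient.inductionOn with | _ a
        exact Setoid.trans' _ (Setoid.symm' _ (hj' a j')) (hVV a v)
    constructor
    intro x y
    induction x using Quotient.inductionOn
    induction y using Quotient.inductionOn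
    exact Quotient.sound (Setoid.trans' _ (hall _) (Setoid.symm' _ (hall _)))
  -- Starting from no edge, `p |V| - 1` links cannot connect the `p |V| + 1` vertices.
  have h1 := card_quotient_joined_le_union (s := s) (t := t) ∅ (Finset.univ.erase (v, j))
  have h2 : (∅ : Set (T.V × Fin p)) ∪ ↑(Finset.univ.erase (v, j)) = A := by
    ext; simp [A]
  rw [h2, Finset.card_erase_of_mem (Finset.mem_univ _), Finset.card_univ, Fintype.card_prod,
    Fintype.card_fin] at h1
  have h3 := Finite.card_le_one_iff_subsingleton.2 hsub
  have h4 : Function.Injective (Quotient.mk (joined s t (∅ : Set _))) := by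
    intro a b hab
    exact eq_of_joined id (by simp) (Quotient.exact hab)
  have h5 := Nat.card_le_card_of_injective _ h4
  rw [Nat.card_eq_fintype_card, Fintype.card_sum, Fintype.card_sigma] at h5
  have h6 : 0 < Fintype.card T.V * p :=
    Nat.mul_pos (Fintype.card_pos_iff.2 ⟨v⟩) (Fin.pos j)
  unfold TreeLike at h
  rw [mul_comm p] at h
  omega

theorem val_finRotate {n : ℕ} (k : Fin n) :
    (finRotate n k).1 = if k.1 + 1 < n then k.1 + 1 else 0 := by
  cases n with
  | zero => exact k.elim0
  | succ n =>
    rw [coe_finRotate]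
    by_cases h : k = Fin.last n
    · simp [h]
    · have : k.1 < n := lt_of_le_of_ne (Nat.lt_succ_iff.1 k.2) fun h' => h (Fin.ext h')
      rw [if_neg h, if_pos (by omega)]

theorem isCyclic_of_walk {L : Type*} {T : StarGraph L} (hT : T.IsTest) (l : List T.E)
    (hnd : l.Nodup) (hl : ∀ e, e ∈ l) {v : T.V} (hw : IsWalk T.src T.tgt v l v) : T.IsCyclic := by
  classical
  rw [isCyclic_iff_exists_fin]
  refine ⟨hT, l.length, (hnd.getEquivOfForallMemList l hl), fun k => ?_⟩
  obtain ⟨x, h0, h1, h2⟩ := hw.exists_seq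
  change T.tgt l[k.1] = T.src l[(finRotate l.length k).1]
  rw [(h2 _ k.2).2, (h2 _ (finRotate l.length k).2).1]
  rw [val_finRotate]
  split_ifs with h
  · rfl
  · rw [h0, ← h1]
    congr 1
    exact le_antisymm k.2 (not_lt.1 h)

theorem IsCyclic.exists_walk {L : Type*} {T : StarGraph L} (hT : T.IsCyclic) :
    ∃ (l : List T.E) (v : T.V), l.Nodup ∧ (∀ e, e ∈ l) ∧ IsWalk T.src T.tgt v l v := by
  rw [isCyclic_iff_exists_fin] at hT
  obtain ⟨⟨⟨v⟩, -⟩, n, c, hc⟩ := hT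
  cases n with
  | zero =>
    refine ⟨[], v, List.nodup_nil, fun e => ?_, rfl⟩
    exact (c.symm e).elim0
  | succ n =>
    -- The value past `n` is the starting point, so that the walk closes up.
    let x : ℕ → T.V := fun i => if i ≤ n then T.src (c (Fin.ofNat (n + 1) i)) else T.src (c 0)
    have hx0 : x 0 = T.src (c 0) := by simp only [x, Nat.zero_le, if_true]; rfl
    refine ⟨List.ofFn c, T.src (c 0), List.nodup_ofFn.2 c.injective,
      fun e => (List.mem_ofFn' _ _).2 (c.surjective e), ?_⟩
    have := isWalk_of_seq (s := T.src) (t := T.tgt) (List.ofFn c) x ?_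
    · rw [List.length_ofFn, hx0] at this
      simpa [x] using this
    · intro i hi
      rw [List.length_ofFn] at hi
      simp only [List.getElem_ofFn]
      have hi' : (Fin.ofNat (n + 1) i) = ⟨i, hi⟩ := Fin.ext (Nat.mod_eq_of_lt hi)
      refine ⟨by simp only [x, if_pos (Nat.lt_succ_iff.1 hi), hi'], ?_⟩
      rw [hc]
      by_cases h : i + 1 ≤ n
      · simp only [x, if_pos h]
        congr 2
        apply Fin.ext
        rw [val_finRotate, if_pos (by simpa using Nat.lt_succ_of_le h)]
        exact (Nat.mod_eq_of_lt (Nat.lt_succ_of_le h)).symm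
      · simp only [x, if_neg h]
        congr 2
        apply Fin.ext
        rw [val_finRotate, if_neg (by simpa using h)]
        rfl

/-- The components of a cyclic free product are cyclic. -/
theorem TreeLike.colorPiece_isCyclic (h : T.TreeLike) (hT : T.IsCyclic) (j : Fin p)
    (K : Quotient (T.joinedIn j)) : (T.colorPiece j K).IsCyclic := by
  classical
  let Cset : T.E → Prop := fun e => (T.γ e).1 = j ∧ Quotient.mk _ (T.src e) = K
  let val : (T.colorPiece j K).E → T.E := fun e => e.1.1
  have hval : Function.Injective val := fun a b hab => Subtype.ext (Subtype.ext hab)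
  have hC : ∀ e, Cset (val e) := fun e => ⟨e.1.2, e.2⟩
  obtain ⟨l, v₀, hnd, hl, hw⟩ := hT.exists_walk
  let l' : List (T.colorPiece j K).E := (l.filter fun e => decide (Cset e)).pmap
    (fun e (he : Cset e) => ⟨⟨e, he.1⟩, he.2⟩) (fun e he => by simpa using (List.mem_filter.1 he).2)
  have hl' : l'.map val = l.filter fun e => decide (Cset e) := by
    refine (List.map_pmap _).trans (List.pmap_eq_self.2 ?_)
    intro a h
    rfl
  have hmem : ∀ e, e ∈ l' := by
    intro e
    have : val e ∈ l'.map val := by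
      rw [hl']; exact List.mem_filter.2 ⟨hl _, by simpa using hC e⟩
    obtain ⟨e', he', h'⟩ := List.mem_map.1 this
    rwa [← hval h']
  have hnd' : l'.Nodup := by
    refine List.Nodup.of_map val ?_
    rw [hl']; exact hnd.filter _
  -- Contract all the edges outside the component: they become loops and can be deleted from the
  -- closed walk of `T`, while by `eq_of_joinedBy` the vertices of the component stay distinct. What
  -- is left is a closed walk in the component.
  let r : Setoid T.V := T.joinedBy {e | ¬ Cset e}
  let q : T.V → Quotient r := Quotient.mk r
  have hw1 := (hw.comp q).filter (p := fun e => decide (Cset e)) ?_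
  · rw [← hl', isWalk_map] at hw1
    let q' : (T.colorPiece j K).V → Quotient r := fun v => q v.1
    have hq' : Function.Injective q' := fun v w hvw =>
      Subtype.ext (h.eq_of_joinedBy hT.1 v.2 w.2 (Quotient.exact hvw))
    have hw2 : IsWalk (q' ∘ (T.colorPiece j K).src) (q' ∘ (T.colorPiece j K).tgt)
      (q v₀) l' (q v₀) := hw1
    -- The contracted base point `q v₀` is known to come from the component only through the first
    -- edge of `l'`; an isolated vertex needs a base point of its own.
    have hwalk : ∃ v, IsWalk (T.colorPiece j K).src (T.colorPiece j K).tgt v l' v := by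
      cases hl'' : l' with
      | nil =>
        obtain ⟨v⟩ := (T.colorPiece_isTest j K).1
        exact ⟨v, rfl⟩
      | cons e l'' =>
        rw [hl''] at hw2
        refine ⟨(T.colorPiece j K).src e, IsWalk.of_comp_injective hq' ?_⟩
        have h0 : q' ((T.colorPiece j K).src e) = q v₀ := hw2.1
        rw [h0]
        exact hw2
    obtain ⟨v, hv⟩ := hwalk
    exact isCyclic_of_walk (T.colorPiece_isTest j K) l' hnd' hmem hv
  · intro e he
    exact Quotient.sound (joined_edge (s := T.src) (t := T.tgt) (by simpa using he))

end Free

end StarGraph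

/-! ### Free products by Euler characteristic -/

namespace StarGraph

variable {p : ℕ} {ι : Fin p → Type u} {T : StarGraph (Σ j, ι j)}

/-- The component of the edge `e`. -/
def edgeComp (T : StarGraph (Σ j, ι j)) (e : T.E) : T.ColorComp :=
  ⟨⟨(T.γ e).1, Quotient.mk _ (T.src e)⟩, e, rfl, rfl⟩

theorem memComp_src (e : T.E) : T.MemComp (T.src e) (T.edgeComp e) := rfl

theorem memComp_tgt (e : T.E) : T.MemComp (T.tgt e) (T.edgeComp e) := T.mk_tgt_eq e rfl

theorem redGraph_adj_iff {C : T.ColorComp} {v : T.Connector} :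
    T.redGraph.Adj (Sum.inl C) (Sum.inr v) ↔ T.MemComp v.1 C := by
  rw [redGraph, SimpleGraph.fromRel_adj]
  constructor
  · rintro ⟨-, ⟨C', v', h1, h2, h⟩ | ⟨C', v', h1, h2, h⟩⟩
    · rw [Sum.inl.inj h1, Sum.inr.inj h2]
      exact h
    · cases h1
  · exact fun h => ⟨by simp only [ne_eq, reduceCtorEq, not_false_eq_true],
      Or.inl ⟨C, v, rfl, rfl, h⟩⟩

theorem redGraph_connected (hT : T.IsTest) (hE : Nonempty T.E) : T.redGraph.Connected := by
  have hstep : ∀ (v : T.V) (C D : T.ColorComp), T.MemComp v C → T.MemComp v D →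
      T.redGraph.Reachable (Sum.inl C) (Sum.inl D) := by
    intro v C D hC hD
    by_cases h : C = D
    · rw [h]
    · let v' : T.Connector := ⟨v, C, D, h, hC, hD⟩
      have h1 : T.redGraph.Adj (Sum.inl C) (Sum.inr v') := redGraph_adj_iff.2 hC
      have h2 : T.redGraph.Adj (Sum.inl D) (Sum.inr v') := redGraph_adj_iff.2 hD
      exact h1.reachable.trans h2.symm.reachable
  obtain ⟨e₀⟩ := hE
  have hv : ∀ v w : T.V, ∀ C D, T.MemComp v C → T.MemComp w D →
      T.redGraph.Reachable (Sum.inl C) (Sum.inl D) := by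
    -- The existence of components through both vertices is what makes the relation transitive; the
    -- alternative `v = w` keeps it reflexive.
    let r : Setoid T.V :=
      { r := fun v w => v = w ∨ ((∃ C, T.MemComp v C) ∧ (∃ D, T.MemComp w D) ∧
          ∀ C D, T.MemComp v C → T.MemComp w D →
            T.redGraph.Reachable (Sum.inl C) (Sum.inl D))
        iseqv :=
          { refl := fun _ => Or.inl rfl
            symm := by
              rintro v w (rfl | ⟨h1, h2, h3⟩)
              · exact Or.inl rfl
              · exact Or.inr ⟨h2, h1, fun C D hC hD => (h3 D C hD hC).symm⟩
            trans := by
              rintro v w x (rfl | ⟨h1, h2, h3⟩) (rfl | ⟨h4, h5, h6⟩)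
              · exact Or.inl rfl
              · exact Or.inr ⟨h4, h5, h6⟩
              · exact Or.inr ⟨h1, h2, h3⟩
              · obtain ⟨E, hE⟩ := h2
                exact Or.inr ⟨h1, h5, fun C D hC hD => (h3 C E hC hE).trans (h6 E D hE hD)⟩ } }
    intro v w C D hC hD
    have : T.joinedBy Set.univ ≤ r := joined_le (s := T.src) (t := T.tgt) fun e _ =>
      Or.inr ⟨⟨_, memComp_src e⟩, ⟨_, memComp_tgt e⟩, fun C D hC hD =>
        (hstep _ C _ hC (memComp_src e)).trans (hstep _ _ D (memComp_tgt e) hD)⟩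
    rcases this (hT.2 v w) with rfl | ⟨-, -, h⟩
    · exact hstep v C D hC hD
    · exact h C D hC hD
  have hC : ∀ C : T.ColorComp, ∃ v, T.MemComp v C := by
    rintro ⟨⟨j, K⟩, e, he, hK⟩
    exact ⟨T.src e, hK⟩
  have hall : ∀ x, T.redGraph.Reachable x (Sum.inl (T.edgeComp e₀)) := by
    have hl : ∀ C, T.redGraph.Reachable (Sum.inl C) (Sum.inl (T.edgeComp e₀)) := fun C => by
      obtain ⟨v, hv'⟩ := hC C
      exact hv _ _ _ _ hv' (memComp_src e₀)
    rintro (C | v)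
    · exact hl C
    · obtain ⟨C, D, -, hvC, -⟩ := v.2
      exact (redGraph_adj_iff.2 hvC : T.redGraph.Adj _ (Sum.inr v)).symm.reachable.trans (hl C)
  have : Nonempty (T.ColorComp ⊕ T.Connector) := ⟨Sum.inl (T.edgeComp e₀)⟩
  exact ⟨fun x y => (hall x).trans (hall y).symm⟩

theorem exists_memComp (hT : T.IsTest) (hE : Nonempty T.E) (v : T.V) : ∃ C, T.MemComp v C := by
  obtain ⟨e⟩ := hE
  by_contra hcon
  have := eq_of_joined (s := T.src) (t := T.tgt) (fun w => w = v) ?_ (hT.2 v (T.src e))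
  · simp only [eq_iff_iff, true_iff] at this
    exact hcon ⟨_, this ▸ memComp_src e⟩
  · intro e _
    have h1 : T.src e ≠ v := fun h => hcon ⟨_, h ▸ memComp_src e⟩
    have h2 : T.tgt e ≠ v := fun h => hcon ⟨_, h ▸ memComp_tgt e⟩
    simp [h1, h2]

/-- A class that contains no edge is a singleton. -/
theorem eq_of_joinedIn {j : Fin p} {v w : T.V}
    (h : ¬ ∃ e, (T.γ e).1 = j ∧ Quotient.mk (T.joinedIn j) (T.src e) = Quotient.mk _ v)
    (hvw : T.joinedIn j v w) : v = w := by
  have := eq_of_joined (s := T.src) (t := T.tgt) (fun x => x = v) ?_ hvw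
  · simpa [eq_comm] using this
  · intro e he
    have h1 : T.src e ≠ v := fun h' => h ⟨e, he, by rw [h']⟩
    have h2 : T.tgt e ≠ v := fun h' => h ⟨e, he, by rw [← h', T.mk_tgt_eq e he]⟩
    simp [h1, h2]

open Classical in
-- A class without edge is a single vertex, so these classes correspond to the pairs of a colour and
-- a vertex lying in no component of that colour. They contribute equally to vertices and to links
-- of the bipartite graph, and cancel.
theorem sum_card_comps (T : StarGraph (Σ j, ι j)) :
    ∑ j, Fintype.card (Quotient (T.joinedIn j)) +
      Fintype.card {x : T.ColorComp × T.V // T.MemComp x.2 x.1} =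
    Fintype.card T.ColorComp + p * Fintype.card T.V := by
  let hasEdge : (Σ j : Fin p, Quotient (T.joinedIn j)) → Prop := fun C =>
    ∃ e, (T.γ e).1 = C.1 ∧ Quotient.mk _ (T.src e) = C.2
  let cls : Fin p × T.V → (Σ j : Fin p, Quotient (T.joinedIn j)) := fun x => ⟨x.1, Quotient.mk _ x.2⟩
  have h1 : ∑ j, Fintype.card (Quotient (T.joinedIn j)) =
      Fintype.card T.ColorComp + Fintype.card {C // ¬ hasEdge C} := by
    rw [← Fintype.card_sigma, ← Fintype.card_congr (Equiv.sumCompl hasEdge), Fintype.card_sum]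
  have h2 : p * Fintype.card T.V = Fintype.card {x : T.ColorComp × T.V // T.MemComp x.2 x.1} +
      Fintype.card {C // ¬ hasEdge C} := by
    have hp : p * Fintype.card T.V = Fintype.card (Fin p × T.V) := by
      rw [Fintype.card_prod, Fintype.card_fin]
    rw [hp, ← Fintype.card_congr (Equiv.sumCompl fun x => hasEdge (cls x)), Fintype.card_sum]
    congr 1
    · refine Fintype.card_congr
        { toFun := fun x => ⟨(⟨cls x.1, x.2⟩, x.1.2), rfl⟩
          invFun := fun y => ⟨(y.1.1.1.1, y.1.2), ?_⟩
          left_inv := ?_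
          right_inv := ?_ }
      · have hy : cls (y.1.1.1.1, y.1.2) = y.1.1.1 := Sigma.ext rfl (heq_of_eq y.2)
        rw [hy]; exact y.1.1.2
      · intro x; rfl
      · rintro ⟨⟨⟨⟨j, K⟩, hK⟩, v⟩, hv⟩
        have hv' : Quotient.mk _ v = K := hv
        subst hv'
        rfl
    · refine Fintype.card_congr (Equiv.ofBijective
        (fun x => (⟨cls x.1, x.2⟩ : {C // ¬ hasEdge C})) ⟨?_, ?_⟩)
      · rintro ⟨⟨j, v⟩, hx⟩ ⟨⟨j', w⟩, hy⟩ h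
        have h' : cls (j, v) = cls (j', w) := congrArg Subtype.val h
        obtain rfl : j = j' := congrArg Sigma.fst h'
        have := eq_of_joinedIn hx (Quotient.exact (eq_of_heq (Sigma.mk.inj h').2))
        subst this
        rfl
      · rintro ⟨⟨j, K⟩, hK⟩
        induction K using Quotient.inductionOn with | _ v
        exact ⟨⟨(j, v), hK⟩, rfl⟩
  omega

open Classical in
-- Every vertex lies in some component. If it lies in exactly one, it contributes one to both sides;
-- a connector contributes its multiplicity plus one to both sides.
theorem card_memComp (hT : T.IsTest) (hE : Nonempty T.E) :
    Fintype.card {x : T.ColorComp × T.V // T.MemComp x.2 x.1} + Fintype.card T.Connector =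
      Nat.card T.redGraph.edgeSet + Fintype.card T.V := by
  let mult : T.V → ℕ := fun v => Fintype.card {C // T.MemComp v C}
  have hmult : ∀ v, 1 ≤ mult v := fun v => by
    obtain ⟨C, hC⟩ := exists_memComp hT hE v
    exact Fintype.card_pos_iff.2 ⟨⟨C, hC⟩⟩
  have hconn : ∀ v, (∃ C D : T.ColorComp, C ≠ D ∧ T.MemComp v C ∧ T.MemComp v D) ↔ 1 < mult v := by
    intro v
    rw [Fintype.one_lt_card_iff]
    constructor
    · rintro ⟨C, D, h, hC, hD⟩
      exact ⟨⟨C, hC⟩, ⟨D, hD⟩, fun h' => h (congrArg Subtype.val h')⟩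
    · rintro ⟨C, D, h⟩
      exact ⟨C, D, fun h' => h (Subtype.ext h'), C.2, D.2⟩
  have hedge : Nat.card T.redGraph.edgeSet = ∑ v : T.Connector, mult v.1 := by
    rw [← Fintype.card_sigma, ← Nat.card_eq_fintype_card]
    refine (Nat.card_congr (Equiv.ofBijective (fun x : Σ v : T.Connector, {C // T.MemComp v.1 C} =>
      (⟨s(Sum.inl x.2.1, Sum.inr x.1), redGraph_adj_iff.2 x.2.2⟩ : T.redGraph.edgeSet))
      ⟨?_, ?_⟩)).symm
    · rintro ⟨v, C, hC⟩ ⟨w, D, hD⟩ h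
      have h' := congrArg Subtype.val h
      simp only [Sym2.eq_iff, Sum.inl.injEq, Sum.inr.injEq, reduceCtorEq, and_self, or_false] at h'
      obtain ⟨rfl, rfl⟩ := h'
      rfl
    · rintro ⟨e, he⟩
      induction e using Sym2.ind with | _ a b
      have hab : T.redGraph.Adj a b := he
      have := hab
      rw [redGraph, SimpleGraph.fromRel_adj] at this
      obtain ⟨-, ⟨C, v, rfl, rfl, h⟩ | ⟨C, v, rfl, rfl, h⟩⟩ := this
      · exact ⟨⟨v, C, h⟩, rfl⟩
      · exact ⟨⟨v, C, h⟩, Subtype.ext Sym2.eq_swap⟩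
  have hpairs : Fintype.card {x : T.ColorComp × T.V // T.MemComp x.2 x.1} = ∑ v, mult v := by
    rw [← Fintype.card_sigma]
    exact Fintype.card_congr
      { toFun := fun x => ⟨x.1.2, x.1.1, x.2⟩
        invFun := fun x => ⟨(x.2.1, x.1), x.2.2⟩
        left_inv := fun _ => rfl
        right_inv := fun _ => rfl }
  have e1 : ∑ v : T.Connector, mult v.1 = ∑ v, if 1 < mult v then mult v else 0 := by
    rw [← Finset.sum_filter]
    exact (Finset.sum_subtype _ (fun v => by rw [Finset.mem_filter, hconn]; exact and_iff_right (Finset.mem_univ v)) _).symm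
  have e2 : Fintype.card T.Connector = ∑ v, if 1 < mult v then 1 else 0 := by
    rw [← Finset.card_filter]
    exact Fintype.card_of_subtype _ (fun v => by rw [Finset.mem_filter, hconn]; exact and_iff_right (Finset.mem_univ v))
  rw [hpairs, hedge, e1, e2, Fintype.card_eq_sum_ones, ← Finset.sum_add_distrib,
    ← Finset.sum_add_distrib]
  refine Finset.sum_congr rfl fun v _ => ?_
  have := hmult v
  split_ifs <;> omega

theorem treeLike_of_isEmpty (hT : T.IsTest) (hE : IsEmpty T.E) : T.TreeLike := by
  have hV : Fintype.card T.V = 1 := by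
    obtain ⟨v⟩ := hT.1
    refine Fintype.card_eq_one_iff.2 ⟨v, fun w => ?_⟩
    exact eq_of_joined (s := T.src) (t := T.tgt) id (fun e => (hE.false e).elim) (hT.2 w v)
  have := Fintype.card_eq_one_iff_nonempty_unique.1 hV
  obtain ⟨hu⟩ := this
  have hq : ∀ j, Fintype.card (Quotient (T.joinedIn j)) = 1 := fun j => by
    rw [Fintype.card_eq_one_iff]
    refine ⟨Quotient.mk _ default, fun y => ?_⟩
    induction y using Quotient.inductionOn with | _ w
    rw [Subsingleton.elim w default]
  unfold TreeLike
  rw [Finset.sum_congr rfl fun j _ => hq j, hV]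
  simp

theorem sum_card_le (hT : T.IsTest) :
    ∑ j, Fintype.card (Quotient (T.joinedIn j)) + Fintype.card T.V ≤ p * Fintype.card T.V + 1 := by
  classical
  rcases isEmpty_or_nonempty T.E with hE | hE
  · exact (treeLike_of_isEmpty hT hE).le
  · have h1 := sum_card_comps T
    have h2 := card_memComp hT hE
    have h3 := (redGraph_connected hT hE).card_vert_le_card_edgeSet_add_one
    rw [Nat.card_eq_fintype_card (α := T.ColorComp ⊕ T.Connector), Fintype.card_sum] at h3
    omega

/-- By `sum_card_comps` and `card_memComp`, the bipartite graph of all classes and `G_red` have the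
same number of vertices minus edges. As `G_red` is connected, being a tree amounts to this number
being one. -/
theorem isFreeProduct_iff (hT : T.IsTest) : T.IsFreeProduct ↔ T.TreeLike := by
  classical
  rcases isEmpty_or_nonempty T.E with hE | hE
  · exact ⟨fun _ => treeLike_of_isEmpty hT hE, fun _ => Or.inl hE⟩
  · have h1 := sum_card_comps T
    have h2 := card_memComp hT hE
    have hc := redGraph_connected hT hE
    rw [IsFreeProduct, SimpleGraph.isTree_iff_connected_and_card,
      Nat.card_eq_fintype_card (α := T.ColorComp ⊕ T.Connector), Fintype.card_sum, TreeLike]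
    simp only [not_isEmpty_of_nonempty, false_or, hc, true_and]
    omega

/-- The edges of a component are the edges of its color starting in it. -/
noncomputable def compEdgeEquiv (T : StarGraph (Σ j, ι j)) (C : T.ColorComp) :
    (T.colorPiece C.1.1 C.1.2).E ≃ (T.comp C).E where
  toFun e := ⟨e.1.1, e.1.2, e.2⟩
  invFun e := ⟨⟨e.1, e.2.1⟩, e.2.2⟩
  left_inv _ := rfl
  right_inv _ := rfl

theorem TreeLike.comp_isCyclic (h : T.TreeLike) (hT : T.IsCyclic) (C : T.ColorComp) :
    (T.comp C).IsCyclic :=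
  isCyclic_of_equiv (T := T.colorPiece C.1.1 C.1.2) (Equiv.refl _) (T.compEdgeEquiv C)
    (fun _ => rfl) (fun _ => rfl) (h.colorPiece_isCyclic hT C.1.1 C.1.2)

end StarGraph

theorem prod_univ_congr {α M : Type*} [CommMonoid M] {i₁ i₂ : Fintype α} {f g : α → M}
    (h : ∀ a, f a = g a) :
    (@Finset.univ α i₁).prod f = (@Finset.univ α i₂).prod g := by
  rw [Subsingleton.elim i₁ i₂]
  exact Finset.prod_congr rfl fun a _ => h a

theorem sum_univ_congr {α M : Type*} [AddCommMonoid M] {i₁ i₂ : Fintype α} {f g : α → M}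
    (h : ∀ a, f a = g a) :
    (@Finset.univ α i₁).sum f = (@Finset.univ α i₂).sum g := by
  rw [Subsingleton.elim i₁ i₂]
  exact Finset.sum_congr rfl fun a _ => h a

/-! ### Möbius inversion over kernels of maps -/

section Kernels

variable {V X : Type} [Fintype V] [Fintype X]

open Classical in
/-- The sum of `g` over the maps with kernel `ρ`. -/
noncomputable def kerSum (g : (V → X) → ℂ) (ρ : Setoid V) : ℂ :=
  ∑ φ, if Setoid.ker φ = ρ then g φ else 0

open Classical in
/-- The sum of `g` over the maps that are constant on the blocks of `ρ`. -/
noncomputable def upSum (g : (V → X) → ℂ) (ρ : Setoid V) : ℂ :=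
  ∑ φ, if ρ ≤ Setoid.ker φ then g φ else 0

open Classical in
/-- The sum of `g` over the maps that are injective on the blocks of `r`. -/
noncomputable def transSum (g : (V → X) → ℂ) (r : Setoid V) : ℂ :=
  ∑ φ, if Setoid.ker φ ⊓ r = ⊥ then g φ else 0

theorem kerSum_congr {V X : Type} {i₁ i₂ : Fintype V} {j : Fintype X} {f g : (V → X) → ℂ}
    (h : ∀ φ, f φ = g φ) {ρ : Setoid V} : @kerSum V X i₁ j f ρ = @kerSum V X i₂ j g ρ := by
  rw [Subsingleton.elim i₁ i₂, funext h]

theorem upSum_eq_sum_kerSum (g : (V → X) → ℂ) (ρ : Setoid V) :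
    upSum g ρ = ∑ π ∈ Finset.Ici ρ, kerSum g π := by
  classical
  unfold upSum kerSum
  rw [Finset.sum_comm]
  refine Finset.sum_congr rfl fun φ _ => ?_
  rw [Finset.sum_ite_eq]
  simp [Finset.mem_Ici]

open Classical in
theorem kerSum_eq_sum_upSum (g : (V → X) → ℂ) (ρ : Setoid V) :
    kerSum g ρ = ∑ π ∈ Finset.Ici ρ, IncidenceAlgebra.mu ℂ ρ π * upSum g π :=
  IncidenceAlgebra.moebius_inversion_top _ _ (upSum_eq_sum_kerSum g) ρ

theorem kerSum_bot (g : (V → X) → ℂ) :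
    kerSum g ⊥ = ∑ π, moebius V π * upSum g π := by
  classical
  rw [kerSum_eq_sum_upSum]
  unfold moebius
  refine Finset.sum_subset (Finset.subset_univ _) fun π _ h => ?_
  exact absurd (Finset.mem_Ici.2 bot_le) h

open Classical in
theorem kerSum_bot_eq_sum_embedding (g : (V → X) → ℂ) :
    kerSum g ⊥ = ∑ φ : V ↪ X, g φ := by
  unfold kerSum
  rw [← Finset.sum_filter]
  refine Eq.trans (b := ∑ φ : {φ : V → X // Function.Injective φ}, g φ.1)
    (Finset.sum_subtype _ ?_ _) ?_
  · intro φ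
    rw [Finset.mem_filter, Setoid.injective_iff_ker_bot]
    exact and_iff_right (Finset.mem_univ φ)
  · exact Fintype.sum_equiv (Equiv.subtypeInjectiveEquivEmbedding V X) _ _ fun _ => rfl

open Classical in
theorem upSum_eq_sum_quotient (g : (V → X) → ℂ) (ρ : Setoid V) :
    upSum g ρ = ∑ ψ : Quotient ρ → X, g (fun v => ψ (Quotient.mk ρ v)) := by
  unfold upSum
  rw [← Finset.sum_filter]
  refine Eq.trans (b := ∑ φ : {φ : V → X // ρ ≤ Setoid.ker φ}, g φ.1)
    (Finset.sum_subtype _ (by simp) _) ?_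
  exact Fintype.sum_equiv (Setoid.liftEquiv ρ) _ _ fun _ => rfl

open Classical in
theorem transSum_eq_sum_kerSum (g : (V → X) → ℂ) (r : Setoid V) :
    transSum g r = ∑ ρ ∈ Finset.univ.filter (fun ρ => ρ ⊓ r = ⊥), kerSum g ρ := by
  unfold transSum kerSum
  rw [Finset.sum_comm]
  refine Finset.sum_congr rfl fun φ _ => ?_
  rw [Finset.sum_ite_eq]
  simp

open Classical in
-- Among maps injective on the blocks of `r`, those not globally injective have a kernel `ρ ≠ ⊥`
-- with `ρ ⊓ r = ⊥`. Expanding them by Möbius inversion involves only partitions above such a `ρ`,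
-- hence not below `r`; these are negligible for free products.
theorem kerSum_bot_eq_transSum_sub (g : (V → X) → ℂ) (r : Setoid V) :
    kerSum g ⊥ = transSum g r -
      ∑ ρ ∈ Finset.univ.filter (fun ρ => ρ ⊓ r = ⊥ ∧ ρ ≠ ⊥), ∑ π ∈ Finset.Ici ρ,
        IncidenceAlgebra.mu ℂ ρ π * upSum g π := by
  have h : (Finset.univ.filter (fun ρ : Setoid V => ρ ⊓ r = ⊥)) =
      insert ⊥ (Finset.univ.filter (fun ρ => ρ ⊓ r = ⊥ ∧ ρ ≠ ⊥)) := by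
    ext ρ
    by_cases hρ : ρ = ⊥ <;> simp [hρ]
  rw [transSum_eq_sum_kerSum, h, Finset.sum_insert (by simp), eq_sub_iff_add_eq]
  simp only [← kerSum_eq_sum_upSum]

end Kernels

/-! ### Traces as kernel sums, and their factorization over pieces -/

section Traces

open StarGraph

variable {L : Type u} {N : ℕ}

/-- The product of the entries of the matrices along the edges of `T`. -/
noncomputable def weight (T : StarGraph L) (A : L → Matrix (Fin N) (Fin N) ℂ)
    (φ : T.V → Fin N) : ℂ :=
  ∏ e : T.E, letter A (T.γ e, T.ε e) (φ (T.src e)) (φ (T.tgt e))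

open Classical in
theorem trace_eq_sum_weight (T : StarGraph L) (A : L → Matrix (Fin N) (Fin N) ℂ) :
    trace T A = (N : ℂ)⁻¹ * ∑ φ, weight T A φ := rfl

theorem injTrace_eq_kerSum (T : StarGraph L) (A : L → Matrix (Fin N) (Fin N) ℂ) :
    injTrace T A = (N : ℂ)⁻¹ * kerSum (weight T A) ⊥ := by
  classical
  rw [kerSum_bot_eq_sum_embedding]
  rfl

theorem trace_quot (T : StarGraph L) (A : L → Matrix (Fin N) (Fin N) ℂ) (π : Setoid T.V) :
    trace (T.quot π) A = (N : ℂ)⁻¹ * upSum (weight T A) π := by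
  classical
  rw [upSum_eq_sum_quotient, trace_eq_sum_weight]
  exact congrArg _ (sum_univ_congr fun _ => rfl)

theorem injTrace_eq_sum_trace_quot (T : StarGraph L) (A : L → Matrix (Fin N) (Fin N) ℂ) :
    injTrace T A = ∑ π, moebius T.V π * trace (T.quot π) A := by
  rw [injTrace_eq_kerSum, kerSum_bot, Finset.mul_sum]
  refine Finset.sum_congr rfl fun π _ => ?_
  rw [trace_quot]
  ring

theorem injTrace_quot (T : StarGraph L) (A : L → Matrix (Fin N) (Fin N) ℂ) (π : Setoid T.V) :
    injTrace (T.quot π) A = (N : ℂ)⁻¹ * kerSum (weight T A) π := by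
  classical
  rw [injTrace_eq_kerSum]
  congr 1
  unfold kerSum
  rw [← Finset.sum_filter, ← Finset.sum_filter]
  refine Finset.sum_bij' (fun ψ _ v => ψ (Quotient.mk π v))
    (fun φ hφ => Quotient.lift φ ((Finset.mem_filter.1 hφ).2 ▸ fun a b h => h)) ?_ ?_ ?_ ?_ ?_
  · intro ψ hψ
    rw [Finset.mem_filter, ← Setoid.injective_iff_ker_bot] at hψ
    rw [Finset.mem_filter]
    refine ⟨Finset.mem_univ _, Setoid.ext fun a b => ?_⟩
    exact ⟨fun h => Quotient.exact (hψ.2 h), fun h => congrArg ψ (Quotient.sound h)⟩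
  · intro φ hφ
    refine Finset.mem_filter.2 ⟨Finset.mem_univ _, (Setoid.injective_iff_ker_bot _).1 ?_⟩
    intro x y h
    induction x using Quotient.inductionOn with | _ a
    induction y using Quotient.inductionOn with | _ b
    have h2 := (Finset.mem_filter.1 hφ).2
    have : Setoid.ker φ a b := h
    rw [h2] at this
    exact Quotient.sound this
  · intro ψ _
    funext x
    induction x using Quotient.inductionOn
    rfl
  · intro φ _
    rfl
  · intro ψ _
    rfl

theorem trace_eq_sum_injTrace_quot (T : StarGraph L) (A : L → Matrix (Fin N) (Fin N) ℂ) :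
    trace T A = ∑ π, injTrace (T.quot π) A := by
  classical
  have h := upSum_eq_sum_kerSum (weight T A) ⊥
  have h2 : upSum (weight T A) ⊥ = ∑ φ, weight T A φ := by simp [upSum]
  have h3 : Finset.Ici (⊥ : Setoid T.V) = Finset.univ := by ext; simp
  rw [trace_eq_sum_weight]
  simp only [injTrace_quot, ← Finset.mul_sum]
  rw [← h3, ← h, h2]

section Pieces

variable (T : StarGraph L) (r : Setoid T.V) (h : ∀ e, r (T.src e) (T.tgt e))
  (A : L → Matrix (Fin N) (Fin N) ℂ)

/-- A map is the family of its restrictions to the blocks of a partition. -/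
def piBlocksEquiv {V : Type} (r : Setoid V) (X : Type) :
    (V → X) ≃ ∀ K : Quotient r, {v // Quotient.mk r v = K} → X where
  toFun φ _ v := φ v.1
  invFun ψ v := ψ (Quotient.mk r v) ⟨v, rfl⟩
  left_inv _ := rfl
  right_inv ψ := by
    funext K ⟨v, hv⟩
    subst hv
    rfl

open Classical in
theorem sum_prod_blocks {V X : Type} [Fintype V] [Fintype X] (r : Setoid V)
    (g : ∀ K : Quotient r, ({v // Quotient.mk r v = K} → X) → ℂ) :
    ∑ φ : V → X, ∏ K, g K (fun v => φ v.1) = ∏ K, ∑ ψ, g K ψ := by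
  rw [Fintype.prod_sum]
  exact Fintype.sum_equiv (piBlocksEquiv r X) _ _ fun _ => rfl

theorem weight_eq_prod_pieces (φ : T.V → Fin N) :
    weight T A φ = ∏ K, weight (T.piece r h K) A (fun v => φ v.1) := by
  unfold weight
  classical
  rw [← Equiv.prod_comp (Equiv.sigmaFiberEquiv fun e => Quotient.mk r (T.src e)),
    Fintype.prod_sigma]
  refine Finset.prod_congr rfl fun K _ => ?_
  exact prod_univ_congr fun _ => rfl

open Classical in
theorem sum_weight_eq_prod_pieces (hN : N ≠ 0) :
    ∑ φ, weight T A φ = (N : ℂ) ^ Fintype.card (Quotient r) * ∏ K, trace (T.piece r h K) A := by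
  classical
  have hN' : (N : ℂ) ≠ 0 := Nat.cast_ne_zero.2 hN
  rw [← Finset.card_univ, ← Finset.prod_const, ← Finset.prod_mul_distrib]
  simp only [trace_eq_sum_weight, mul_inv_cancel_left₀ hN']
  simp only [weight_eq_prod_pieces T r h A]
  refine (sum_prod_blocks r fun K ψ => weight (T.piece r h K) A ψ).trans ?_
  exact Finset.prod_congr rfl fun K _ => sum_univ_congr fun _ => rfl

/-- Both the weight and the condition of injectivity on each block are products over the blocks. -/
theorem transSum_weight_eq_prod_pieces (hN : N ≠ 0) :
    transSum (weight T A) r =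
      (N : ℂ) ^ Fintype.card (Quotient r) * ∏ K, injTrace (T.piece r h K) A := by
  classical
  have hN' : (N : ℂ) ≠ 0 := Nat.cast_ne_zero.2 hN
  rw [← Finset.card_univ, ← Finset.prod_const, ← Finset.prod_mul_distrib]
  simp only [injTrace_eq_kerSum, mul_inv_cancel_left₀ hN']
  unfold kerSum transSum
  have h1 : ∀ φ : T.V → Fin N, (if Setoid.ker φ ⊓ r = ⊥ then weight T A φ else 0) =
      ∏ K : Quotient r, if Setoid.ker (fun v : {v // Quotient.mk r v = K} => φ v.1) = ⊥ then
        weight (T.piece r h K) A (fun v => φ v.1) else 0 := by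
    intro φ
    have h2 : Setoid.ker φ ⊓ r = ⊥ ↔
        ∀ K : Quotient r, Setoid.ker (fun v : {v // Quotient.mk r v = K} => φ v.1) = ⊥ := by
      constructor
      · intro hφ K
        rw [← Setoid.injective_iff_ker_bot]
        rintro ⟨v, hv⟩ ⟨w, hw⟩ hvw
        have : (Setoid.ker φ ⊓ r) v w := ⟨hvw, Quotient.exact (hv.trans hw.symm)⟩
        rw [hφ] at this
        exact Subtype.ext this
      · intro hφ
        refine le_bot_iff.1 fun v w hvw => ?_
        have := (Setoid.injective_iff_ker_bot _).2 (hφ (Quotient.mk r w))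
        exact congrArg Subtype.val (@this ⟨v, Quotient.sound hvw.2⟩ ⟨w, rfl⟩ hvw.1)
    split_ifs with hφ
    · rw [weight_eq_prod_pieces T r h A]
      exact Finset.prod_congr rfl fun K _ => (if_pos (h2.1 hφ K)).symm
    · rw [h2, not_forall] at hφ
      obtain ⟨K, hK⟩ := hφ
      exact (Finset.prod_eq_zero (Finset.mem_univ K) (if_neg hK)).symm
  simp only [h1]
  refine (sum_prod_blocks r fun K ψ => if Setoid.ker ψ = ⊥ then
    weight (T.piece r h K) A ψ else 0).trans ?_
  exact Finset.prod_congr rfl fun K _ => sum_univ_congr fun _ => rfl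

end Pieces

theorem upSum_weight_eq_prod (T : StarGraph L) (A : L → Matrix (Fin N) (Fin N) ℂ) (hN : N ≠ 0)
    (ρ : Setoid T.V) : upSum (weight T A) ρ = (N : ℂ) ^ Fintype.card (T.quot ρ).Comps *
      ∏ K, trace ((T.quot ρ).conn K) A := by
  classical
  rw [← sum_weight_eq_prod_pieces _ _ _ _ hN, upSum_eq_sum_quotient]
  exact sum_univ_congr fun _ => rfl

theorem weight_joint {p : ℕ} {ι : Fin p → Type u} (T : StarGraph (Σ j, ι j))
    (A : ∀ j, ι j → Matrix (Fin N) (Fin N) ℂ) (φ : T.V → Fin N) :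
    weight T (fun x => A x.1 x.2) φ = ∏ j, weight (T.restrict j) (A j) φ := by
  classical
  unfold weight
  rw [← Equiv.prod_comp (Equiv.sigmaFiberEquiv fun e => (T.γ e).1), Fintype.prod_sigma]
  refine Finset.prod_congr rfl fun j _ => ?_
  refine prod_univ_congr fun e => ?_
  obtain ⟨e, he⟩ := e
  subst he
  rfl

theorem injTrace_comp {p : ℕ} {ι : Fin p → Type u} (T : StarGraph (Σ j, ι j)) (C : T.ColorComp)
    (A : ι C.1.1 → Matrix (Fin N) (Fin N) ℂ) :
    injTrace (T.comp C) A = injTrace (T.colorPiece C.1.1 C.1.2) A := by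
  classical
  have hw : ∀ φ : {v : T.V // T.MemComp v C} → Fin N,
      weight (T.comp C) A φ = weight (T.colorPiece C.1.1 C.1.2) A φ := by
    intro φ
    unfold weight
    rw [← Equiv.prod_comp (T.compEdgeEquiv C)]
    rfl
  rw [injTrace_eq_kerSum, injTrace_eq_kerSum]
  exact congrArg ((N : ℂ)⁻¹ * ·) (kerSum_congr hw)

/-- One vertex has `N` images, each of weight one, and the normalization removes the `N`. Isolated
vertices of a colour are thus harmless factors. -/
theorem injTrace_of_isolated {p : ℕ} {ι : Fin p → Type u} (T : StarGraph (Σ j, ι j)) (j : Fin p)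
    (K : Quotient (T.joinedIn j)) (hK : ¬ ∃ e, (T.γ e).1 = j ∧ Quotient.mk _ (T.src e) = K)
    (hN : N ≠ 0) (A : ι j → Matrix (Fin N) (Fin N) ℂ) : injTrace (T.colorPiece j K) A = 1 := by
  classical
  have hE : IsEmpty (T.colorPiece j K).E := ⟨fun e => hK ⟨e.1.1, e.1.2, e.2⟩⟩
  have hV : Fintype.card (T.colorPiece j K).V = 1 := by
    obtain ⟨v⟩ := (T.colorPiece_isTest j K).1
    refine Fintype.card_eq_one_iff.2 ⟨v, fun w => ?_⟩
    exact eq_of_joined (s := (T.colorPiece j K).src) (t := (T.colorPiece j K).tgt) id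
      (fun e => (hE.false e).elim) ((T.colorPiece_isTest j K).2 w v)
  have hw : ∀ φ, weight (T.colorPiece j K) A φ = 1 := fun φ => Fintype.prod_empty _
  rw [injTrace_eq_kerSum, kerSum_bot_eq_sum_embedding]
  simp only [hw, Finset.sum_const, Finset.card_univ, Fintype.card_embedding_eq, hV,
    Fintype.card_fin]
  simp [hN]

end Traces

/-! ### Integrability -/

section Moments

variable {Ω : Type*} [MeasurableSpace Ω] {μ : Measure Ω}

/-- `f` has finite moments of any order. -/
def AllMoments (f : Ω → ℂ) (μ : Measure Ω) : Prop := ∀ q : ℕ, MemLp f q μ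

theorem AllMoments.integrable {f : Ω → ℂ} (h : AllMoments f μ) : Integrable f μ := by
  have := h 1
  rwa [Nat.cast_one, memLp_one_iff_integrable] at this

theorem allMoments_const [IsFiniteMeasure μ] (c : ℂ) : AllMoments (fun _ : Ω => c) μ :=
  fun _ => memLp_const c

theorem holderTriple_two_mul (q : ℕ) : ENNReal.HolderTriple ((2 * q : ℕ) : ENNReal)
    ((2 * q : ℕ) : ENNReal) (q : ENNReal) := by
  constructor
  rw [Nat.cast_mul, ENNReal.mul_inv (by simp) (by simp), ← add_mul, Nat.cast_ofNat,
    ENNReal.inv_two_add_inv_two, one_mul]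

theorem AllMoments.mul {f g : Ω → ℂ} (hf : AllMoments f μ) (hg : AllMoments g μ) :
    AllMoments (fun ω => f ω * g ω) μ := fun q =>
  have := holderTriple_two_mul q
  (hg (2 * q)).mul (hf (2 * q))

theorem AllMoments.const_mul {f : Ω → ℂ} (hf : AllMoments f μ) (c : ℂ) :
    AllMoments (fun ω => c * f ω) μ := fun q => (hf q).const_mul c

theorem AllMoments.conj {f : Ω → ℂ} (hf : AllMoments f μ) :
    AllMoments (fun ω => star (f ω)) μ := fun q => (hf q).star

theorem allMoments_sum {κ : Type*} (s : Finset κ) {f : κ → Ω → ℂ}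
    (h : ∀ i ∈ s, AllMoments (f i) μ) : AllMoments (fun ω => ∑ i ∈ s, f i ω) μ :=
  fun q => memLp_finsetSum s fun i hi => h i hi q

theorem allMoments_prod [IsFiniteMeasure μ] {κ : Type*} (s : Finset κ) {f : κ → Ω → ℂ}
    (h : ∀ i ∈ s, AllMoments (f i) μ) : AllMoments (fun ω => ∏ i ∈ s, f i ω) μ := by
  classical
  induction s using Finset.induction_on with
  | empty => simpa using allMoments_const 1
  | insert i s hi ih =>
    simp only [Finset.prod_insert hi]
    exact (h i (Finset.mem_insert_self i s)).mul (ih fun k hk => h k (Finset.mem_insert_of_mem hk))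

variable {L : Type u} {N : ℕ} {A : Ω → L → Matrix (Fin N) (Fin N) ℂ}

theorem allMoments_letter (hA : ∀ l i j, AllMoments (fun ω => A ω l i j) μ) (x : L × Bool)
    (i j : Fin N) : AllMoments (fun ω => letter (A ω) x i j) μ := by
  obtain ⟨l, b⟩ := x
  cases b
  · exact hA l i j
  · exact (hA l j i).conj

variable [IsFiniteMeasure μ]

theorem allMoments_weight (hA : ∀ l i j, AllMoments (fun ω => A ω l i j) μ) (T : StarGraph L)
    (φ : T.V → Fin N) : AllMoments (fun ω => weight T (A ω) φ) μ :=
  allMoments_prod _ fun _ _ => allMoments_letter hA _ _ _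

theorem allMoments_trace (hA : ∀ l i j, AllMoments (fun ω => A ω l i j) μ) (T : StarGraph L) :
    AllMoments (fun ω => trace T (A ω)) μ := by
  classical
  exact (allMoments_sum _ fun φ _ => allMoments_weight hA T φ).const_mul _

theorem allMoments_injTrace (hA : ∀ l i j, AllMoments (fun ω => A ω l i j) μ) (T : StarGraph L) :
    AllMoments (fun ω => injTrace T (A ω)) μ := by
  classical
  simp only [injTrace_eq_sum_trace_quot]
  exact allMoments_sum _ fun π _ => (allMoments_trace hA _).const_mul _

end Moments

/-! ### Measurability, and conjugation by permutation matrices -/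

section Measurability

variable {L : Type u} {N : ℕ}

theorem measurable_letter (x : L × Bool) (i j : Fin N) :
    Measurable fun A : L → Matrix (Fin N) (Fin N) ℂ => letter A x i j := by
  have h : ∀ (l : L) (i j : Fin N), Measurable fun A : L → Matrix (Fin N) (Fin N) ℂ => A l i j := by
    intro l i j
    have h1 : Measurable fun B : Fin N → Fin N → ℂ => B i j :=
      (measurable_pi_apply j).comp (measurable_pi_apply i)
    have h2 : Measurable fun B : Matrix (Fin N) (Fin N) ℂ => B i j := h1
    exact h2.comp (measurable_pi_apply l)
  obtain ⟨l, b⟩ := x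
  cases b
  · exact h l i j
  · exact (continuous_star.measurable).comp (h l j i)

theorem measurable_weight (T : StarGraph L) (φ : T.V → Fin N) :
    Measurable fun A : L → Matrix (Fin N) (Fin N) ℂ => weight T A φ :=
  Finset.measurable_prod _ fun _ _ => measurable_letter _ _ _

theorem permMatrix_conj_apply (σ : Equiv.Perm (Fin N)) (B : Matrix (Fin N) (Fin N) ℂ)
    (i j : Fin N) : (σ.permMatrix ℂ * B * (σ.permMatrix ℂ)ᴴ) i j = B (σ i) (σ j) := by
  simp [Matrix.mul_apply, Equiv.Perm.permMatrix, PEquiv.toMatrix_apply,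
    Equiv.toPEquiv_apply, apply_ite, Equiv.symm_apply_eq]

theorem weight_permMatrix_conj (T : StarGraph L) (A : L → Matrix (Fin N) (Fin N) ℂ)
    (σ : Equiv.Perm (Fin N)) (φ : T.V → Fin N) :
    weight T (fun l => σ.permMatrix ℂ * A l * (σ.permMatrix ℂ)ᴴ) φ = weight T A (σ ∘ φ) := by
  unfold weight
  refine Finset.prod_congr rfl fun e _ => ?_
  unfold letter
  dsimp only
  split_ifs
  · rw [Matrix.conjTranspose_apply, Matrix.conjTranspose_apply, permMatrix_conj_apply]
    rfl
  · rw [permMatrix_conj_apply]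
    rfl

theorem exists_perm_comp_eq {V : Type} {X : Type*} [Finite X] (φ ψ : V ↪ X) :
    ∃ σ : Equiv.Perm X, ∀ v, σ (φ v) = ψ v := by
  classical
  have := Fintype.ofFinite X
  let e : {x // x ∈ Set.range φ} ≃ {x // x ∈ Set.range ψ} :=
    (Equiv.ofInjective φ φ.injective).symm.trans (Equiv.ofInjective ψ ψ.injective)
  refine ⟨e.extendSubtype, fun v => ?_⟩
  rw [Equiv.extendSubtype_apply_of_mem e (φ v) ⟨v, rfl⟩]
  have : (Equiv.ofInjective φ φ.injective).symm ⟨φ v, ⟨v, rfl⟩⟩ = v :=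
    Equiv.ofInjective_symm_apply φ.injective v
  simp [e, this]

end Measurability

/-! ### Factorization of the expected injective trace -/

section Factorization

/-- Two injective maps differ by a permutation of the indices, which conjugation by a permutation
matrix undoes in law. -/
theorem integral_weight_eq_of_permInvariant {L : Type u} {Ω : ℕ → Type*}
    [∀ N, MeasurableSpace (Ω N)] {P : ∀ N, Measure (Ω N)}
    {A : ∀ N, Ω N → L → Matrix (Fin N) (Fin N) ℂ} (h : PermInvariant P A) (N : ℕ)
    (T : StarGraph L) (φ ψ : T.V ↪ Fin N) :
    ∫ ω, weight T (A N ω) φ ∂P N = ∫ ω, weight T (A N ω) ψ ∂P N := by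
  obtain ⟨σ, hσ⟩ := exists_perm_comp_eq φ ψ
  have h1 := ((h N σ).comp (measurable_weight T φ)).integral_eq
  have h2 : (σ ∘ φ : T.V → Fin N) = ψ := funext hσ
  simp only [Function.comp_def, weight_permMatrix_conj] at h1
  rw [← h1, ← h2]
  rfl

/-- A constant factor equals its average and leaves the sum, so one varying factor is allowed. This
is why one family need not be permutation invariant. -/
theorem sum_prod_eq_of_const {Φ κ : Type*} [Fintype Φ] [Nonempty Φ] [Fintype κ] (g : κ → Φ → ℂ)
    (k₀ : κ) (h : ∀ k, k ≠ k₀ → ∀ x y, g k x = g k y) :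
    ∑ x, ∏ k, g k x =
      (Fintype.card Φ : ℂ) * ∏ k, ((Fintype.card Φ : ℂ)⁻¹ * ∑ x, g k x) := by
  classical
  have hM : (Fintype.card Φ : ℂ) ≠ 0 := Nat.cast_ne_zero.2 Fintype.card_ne_zero
  let x₀ : Φ := Classical.arbitrary Φ
  have h1 : ∀ k ∈ Finset.univ.erase k₀, (Fintype.card Φ : ℂ)⁻¹ * ∑ x, g k x = g k x₀ := by
    intro k hk
    rw [Finset.sum_congr rfl fun x _ => h k (Finset.ne_of_mem_erase hk) x x₀, Finset.sum_const,
      Finset.card_univ, nsmul_eq_mul, inv_mul_cancel_left₀ hM]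
  rw [← Finset.mul_prod_erase _ _ (Finset.mem_univ k₀), Finset.prod_congr rfl h1, ← mul_assoc,
    mul_inv_cancel_left₀ hM, Finset.sum_mul]
  refine Finset.sum_congr rfl fun x _ => ?_
  rw [← Finset.mul_prod_erase _ _ (Finset.mem_univ k₀)]
  congr 1
  exact Finset.prod_congr rfl fun k hk => h k (Finset.ne_of_mem_erase hk) x x₀

variable {p : ℕ} {ι : Fin p → Type u} {Ω : ℕ → Type*} [∀ N, MeasurableSpace (Ω N)]
  {P : ∀ N, Measure (Ω N)} [∀ N, IsProbabilityMeasure (P N)]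
  {X : ∀ j, ∀ N, Ω N → ι j → Matrix (Fin N) (Fin N) ℂ}

/-- The expectation of an injective trace in the joint family factorizes. -/
theorem integral_injTrace_joint (hmeas : ∀ j N, Measurable (X j N))
    (hmom : ∀ j N l a b, AllMoments (fun ω => X j N ω l a b) (P N))
    (hindep : ∀ N, iIndepFun (fun j => X j N) (P N)) (j₀ : Fin p)
    (hinv : ∀ j, j ≠ j₀ → PermInvariant P (X j)) (T : StarGraph (Σ j, ι j)) (N : ℕ)
    (hN : Fintype.card T.V ≤ N) :
    ∫ ω, injTrace T (joint X N ω) ∂P N =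
      (N : ℂ)⁻¹ * ((N.descFactorial (Fintype.card T.V) : ℂ) *
        ∏ j, ((N.descFactorial (Fintype.card T.V) : ℂ)⁻¹ *
          ∫ ω, kerSum (weight (T.restrict j) (X j N ω)) ⊥ ∂P N)) := by
  classical
  have hcard : Fintype.card (T.V ↪ Fin N) = N.descFactorial (Fintype.card T.V) := by
    rw [Fintype.card_embedding_eq, Fintype.card_fin]
  have hne : Nonempty (T.V ↪ Fin N) :=
    Function.Embedding.nonempty_of_card_le (by rwa [Fintype.card_fin])
  have h1 : ∀ ω, injTrace T (joint X N ω) =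
      (N : ℂ)⁻¹ * ∑ φ : T.V ↪ Fin N, ∏ j, weight (T.restrict j) (X j N ω) φ := fun ω => by
    rw [injTrace_eq_kerSum, kerSum_bot_eq_sum_embedding]
    congr 1
    exact Finset.sum_congr rfl fun φ _ => weight_joint T (fun j => X j N ω) φ
  simp only [h1]
  rw [integral_const_mul, integral_finsetSum]
  · congr 1
    have h2 : ∀ φ : T.V ↪ Fin N, ∫ ω, ∏ j, weight (T.restrict j) (X j N ω) φ ∂P N =
        ∏ j, ∫ ω, weight (T.restrict j) (X j N ω) φ ∂P N := fun φ =>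
      (hindep N).integral_fun_prod_comp (f := fun j A => weight (T.restrict j) A φ)
        (fun j => (hmeas j N).aemeasurable)
        (fun j => (measurable_weight (T.restrict j) φ).aestronglyMeasurable)
    simp only [h2]
    rw [sum_prod_eq_of_const (fun j (φ : T.V ↪ Fin N) =>
      ∫ ω, weight (T.restrict j) (X j N ω) φ ∂P N) j₀, hcard]
    · congr 1
      refine Finset.prod_congr rfl fun j _ => ?_
      congr 1
      rw [← integral_finsetSum]
      · congr 1
        funext ω
        exact (kerSum_bot_eq_sum_embedding (V := T.V) _).symm
      · exact fun φ _ => (allMoments_weight (hmom j N) _ _).integrable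
    · exact fun j hj φ ψ => integral_weight_eq_of_permInvariant (hinv j hj) N (T.restrict j) φ ψ
  · exact fun φ _ => (allMoments_prod _ fun j _ => allMoments_weight (hmom j N) _ _).integrable

end Factorization

namespace StarGraph

/-! ### Leaf bounds for quotients of the colour graphs -/

section Exponents

variable {p : ℕ} {ι : Fin p → Type u} {T : StarGraph (Σ j, ι j)}

/-- A map from `V` onto some finite type. -/
structure Onto (V : Type) where
  W : Type
  [fintypeW : Fintype W]
  f : V → W
  surj : Function.Surjective f

attribute [instance] Onto.fintypeW

/-- The quotient map of a partition. -/
noncomputable def Onto.mk' {V : Type} [Fintype V] (π : Setoid V) : Onto V where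
  W := Quotient π
  f := Quotient.mk π
  surj := Quotient.mk_surjective

/-- The identity map. -/
def Onto.id' (V : Type) [Fintype V] : Onto V where
  W := V
  f := id
  surj := Function.surjective_id

theorem card_comps_restrict (T : StarGraph (Σ j, ι j)) (j : Fin p) :
    Fintype.card (T.restrict j).Comps = Fintype.card (Quotient (T.joinedIn j)) :=
  Fintype.card_congr (Quotient.congr (Equiv.refl _) fun a b => by
    rw [← T.joinedBy_restrict j]; rfl)

/-- The canonical map on components induced by a quotient of the vertices. -/
noncomputable def compsMap (T : StarGraph (Σ j, ι j)) (j : Fin p) (π : Setoid T.V) :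
    Quotient (T.joinedIn j) → ((T.restrict j).quot π).Comps :=
  Quotient.lift (fun v => Quotient.mk _ (Quotient.mk π v)) fun a b hab => by
    refine eq_of_joined (s := T.src) (t := T.tgt)
      (fun v => (Quotient.mk _ (Quotient.mk π v) : ((T.restrict j).quot π).Comps))
      (fun e he => ?_) hab
    exact Quotient.sound (((T.restrict j).quot π).joinedBy_univ_edge ⟨e, he⟩)

theorem compsMap_surjective (T : StarGraph (Σ j, ι j)) (j : Fin p) (π : Setoid T.V) :
    Function.Surjective (T.compsMap j π) := by
  intro K
  induction K using Quotient.inductionOn with | _ x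
  obtain ⟨v, rfl⟩ := Quotient.exists_rep x
  exact ⟨Quotient.mk _ v, rfl⟩

theorem card_comps_quot_le (T : StarGraph (Σ j, ι j)) (j : Fin p) (π : Setoid T.V) :
    Fintype.card ((T.restrict j).quot π).Comps ≤ Fintype.card (Quotient (T.joinedIn j)) :=
  Fintype.card_le_of_surjective _ (T.compsMap_surjective j π)

/-- The partition `π` then identifies vertices of two distinct components, which become one. -/
theorem card_comps_quot_lt (T : StarGraph (Σ j, ι j)) (j : Fin p) {π : Setoid T.V}
    (h : ¬ π ≤ T.joinedIn j) :
    Fintype.card ((T.restrict j).quot π).Comps < Fintype.card (Quotient (T.joinedIn j)) := by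
  refine Fintype.card_lt_of_surjective_not_injective _ (T.compsMap_surjective j π) fun hinj => h ?_
  intro v w hvw
  refine Quotient.exact (hinj ?_)
  change Quotient.mk _ (Quotient.mk π v) = Quotient.mk _ (Quotient.mk π w)
  rw [Quotient.sound hvw]

theorem TreeLike.conn_restrict_isCyclic (h : T.TreeLike) (hT : T.IsCyclic) (j : Fin p)
    (K : (T.restrict j).Comps) : ((T.restrict j).conn K).IsCyclic := by
  have key : ∀ (r : Setoid T.V) (hr : ∀ e, r ((T.restrict j).src e) ((T.restrict j).tgt e)),
      r = T.joinedIn j → ∀ K, ((T.restrict j).piece r hr K).IsCyclic := by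
    rintro r hr rfl K
    exact h.colorPiece_isCyclic hT j K
  exact key _ _ (T.joinedBy_restrict j) K

/-- The number of leaves of the quotients of the color graphs, when there are not too many
components. -/
theorem sum_numLeaves_quot_le (hT : T.IsCyclic) (hfree : ¬ T.TreeLike) (π : Fin p → Setoid T.V) :
    ∑ j, ∑ K : ((T.restrict j).quot (π j)).Comps, (((T.restrict j).quot (π j)).conn K).numLeaves +
      2 * Fintype.card T.V ≤ 2 * (p * Fintype.card T.V) := by
  refine sum_numLeaves_le T (fun j => Quotient.mk (π j)) hT (fun j => Quotient.mk_surjective) ?_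
  have h1 := sum_card_le hT.1
  have h2 : ∑ j, Fintype.card ((T.restrict j).quot (π j)).Comps ≤
      ∑ j, Fintype.card (Quotient (T.joinedIn j)) :=
    Finset.sum_le_sum fun j _ => T.card_comps_quot_le j (π j)
  have h3 : ∑ j, Fintype.card (T.colorPush (fun j => Quotient.mk (π j)) j).Comps =
    ∑ j, Fintype.card ((T.restrict j).quot (π j)).Comps := rfl
  unfold TreeLike at hfree
  omega

/-- Quotient by `π` in colour `j` only. This merges two components, so `sum_numLeaves_le` applies to
all colours together. In each other colour the components are cyclic with exactly two leaves, and
subtracting them through the equality `TreeLike` leaves a gain of two in colour `j`. -/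
theorem TreeLike.sum_numLeaves_quot_le (h : T.TreeLike) (hT : T.IsCyclic) (j : Fin p)
    (π : Setoid T.V) (hπ : ¬ π ≤ T.joinedIn j) :
    ∑ K : ((T.restrict j).quot π).Comps, (((T.restrict j).quot π).conn K).numLeaves + 2 ≤
      2 * Fintype.card (Quotient (T.joinedIn j)) := by
  classical
  -- The other colours use the identity of `T.V` and not a quotient by `⊥`, so that their pieces are
  -- literally the components of `T.restrict i`.
  let d : Fin p → Onto T.V := Function.update (fun _ => Onto.id' T.V) j (Onto.mk' π)
  let Φ : Fin p → Onto T.V → ℕ := fun i d =>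
    ∑ K : ((T.restrict i).push d.f).Comps, (((T.restrict i).push d.f).conn K).numLeaves
  let c : Fin p → Onto T.V → ℕ := fun i d => Fintype.card ((T.restrict i).push d.f).Comps
  have hdj : d j = Onto.mk' π := Function.update_self ..
  have hdi : ∀ i ∈ Finset.univ.erase j, d i = Onto.id' T.V := fun i hi =>
    Function.update_of_ne (Finset.ne_of_mem_erase hi) ..
  have hΦj : Φ j (d j) =
      ∑ K : ((T.restrict j).quot π).Comps, (((T.restrict j).quot π).conn K).numLeaves := by
    rw [hdj]; rfl
  have hcj : c j (d j) = Fintype.card ((T.restrict j).quot π).Comps := by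
    rw [hdj]; rfl
  have hci : ∀ i ∈ Finset.univ.erase j, c i (d i) = Fintype.card (Quotient (T.joinedIn i)) := by
    intro i hi
    rw [hdi i hi]
    exact T.card_comps_restrict i
  have hΦi : ∀ i ∈ Finset.univ.erase j,
      Φ i (d i) = Fintype.card (Quotient (T.joinedIn i)) * 2 := by
    intro i hi
    rw [hdi i hi, ← T.card_comps_restrict i]
    change ∑ K : (T.restrict i).Comps, ((T.restrict i).conn K).numLeaves = _
    rw [Finset.sum_congr rfl fun K _ => (h.conn_restrict_isCyclic hT i K).numLeaves,
      Finset.sum_const, Finset.card_univ, smul_eq_mul]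
  have hlt := T.card_comps_quot_lt j hπ
  have key := sum_numLeaves_le T (fun i => (d i).f) hT (fun i => (d i).surj)
  change ∑ i, c i (d i) + _ ≤ _ → ∑ i, Φ i (d i) + _ ≤ _ at key
  rw [← Finset.add_sum_erase _ _ (Finset.mem_univ j), hcj, Finset.sum_congr rfl hci,
    ← Finset.add_sum_erase _ _ (Finset.mem_univ j), hΦj, Finset.sum_congr rfl hΦi,
    ← Finset.sum_mul] at key
  unfold TreeLike at h
  rw [← Finset.add_sum_erase _ _ (Finset.mem_univ j)] at h
  omega

end Exponents

end StarGraph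

/-! ### Consequences of the assumptions for a single family -/

section Limits

variable {L : Type u} {Ω : ℕ → Type*} [∀ N, MeasurableSpace (Ω N)]
  {P : ∀ N, Measure (Ω N)}
  {A : ∀ N, Ω N → L → Matrix (Fin N) (Fin N) ℂ} {τ : StarGraph L → ℂ}

theorem HasLimitingTraffic.allMoments (h : HasLimitingTraffic P A τ) (N : ℕ) (l : L) (i j : Fin N) :
    AllMoments (fun ω => A N ω l i j) (P N) := h.1 N l i j

theorem HasLimitingTraffic.tendsto_injTrace [∀ N, IsProbabilityMeasure (P N)]
    (h : HasLimitingTraffic P A τ) {T : StarGraph L}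
    (hT : T.IsCyclic) :
    Tendsto (fun N => ∫ ω, injTrace T (A N ω) ∂P N) atTop (𝓝 (injVersion τ T)) := by
  have h1 : ∀ N, ∫ ω, injTrace T (A N ω) ∂P N =
      ∑ π, (∫ ω, trace (T.quot π) (A N ω) ∂P N) * moebius T.V π := by
    intro N
    simp only [injTrace_eq_sum_trace_quot]
    rw [integral_finsetSum]
    · exact Finset.sum_congr rfl fun π _ => by rw [integral_const_mul, mul_comm]
    · exact fun π _ => ((allMoments_trace (h.allMoments N) _).const_mul _).integrable
  simp only [h1]
  exact tendsto_finsetSum _ fun π _ => (h.2 _ (hT.quot π)).mul_const _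

theorem Concentrates.tendsto_prod_trace (h : Concentrates P A τ) {κ : Type} [Fintype κ]
    (G : κ → StarGraph L) (hG : ∀ k, (G k).IsCyclic) :
    Tendsto (fun N => ∫ ω, ∏ k, trace (G k) (A N ω) ∂P N) atTop (𝓝 (∏ k, τ (G k))) := by
  let e := Fintype.equivFin κ
  have := h (Fintype.card κ) (fun i => G (e.symm i)) fun i => hG _
  rw [Equiv.prod_comp e.symm (fun k => τ (G k))] at this
  refine this.congr fun N => ?_
  congr 1
  funext ω
  exact Equiv.prod_comp e.symm (fun k => trace (G k) (A N ω))

theorem tendsto_prod_injTrace [∀ N, IsProbabilityMeasure (P N)]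
    (hlim : HasLimitingTraffic P A τ) (h : Concentrates P A τ)
    {κ : Type} [Fintype κ] (G : κ → StarGraph L) (hG : ∀ k, (G k).IsCyclic) :
    Tendsto (fun N => ∫ ω, ∏ k, injTrace (G k) (A N ω) ∂P N) atTop
      (𝓝 (∏ k, injVersion τ (G k))) := by
  classical
  have h1 : ∀ N, ∫ ω, ∏ k, injTrace (G k) (A N ω) ∂P N =
      ∑ π : ∀ k, Setoid (G k).V, (∏ k, moebius (G k).V (π k)) *
        ∫ ω, ∏ k, trace ((G k).quot (π k)) (A N ω) ∂P N := by
    intro N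
    simp only [injTrace_eq_sum_trace_quot, Fintype.prod_sum, Finset.prod_mul_distrib]
    rw [integral_finsetSum]
    · exact Finset.sum_congr rfl fun π _ => integral_const_mul _ _
    · exact fun π _ => ((allMoments_prod _ fun k _ =>
        allMoments_trace (hlim.allMoments N) _).const_mul _).integrable
  have h2 : ∏ k, injVersion τ (G k) = ∑ π : ∀ k, Setoid (G k).V,
      (∏ k, moebius (G k).V (π k)) * ∏ k, τ ((G k).quot (π k)) := by
    simp only [injVersion, Fintype.prod_sum, Finset.prod_mul_distrib]
    exact Finset.sum_congr rfl fun π _ => mul_comm _ _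
  simp only [h1, h2]
  exact tendsto_finsetSum _ fun π _ =>
    (h.tendsto_prod_trace _ fun k => (hG k).quot (π k)).const_mul _

theorem ControlledGrowth.isBigO_prod_trace (h : ControlledGrowth P A) {κ : Type} [Fintype κ]
    (G : κ → StarGraph L) (hG : ∀ k, (G k).IsTest) :
    (fun N => ∫ ω, ∏ k, trace (G k) (A N ω) ∂P N) =O[atTop]
      fun N => (N : ℝ) ^ (∑ k, (((G k).numLeaves : ℝ) / 2 - 1)) := by
  let e := Fintype.equivFin κ
  have := h (Fintype.card κ) (fun i => G (e.symm i)) fun i => hG _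
  rw [Equiv.sum_comp e.symm (fun k => ((G k).numLeaves : ℝ) / 2 - 1)] at this
  refine this.congr_left fun N => ?_
  congr 1
  funext ω
  exact Equiv.prod_comp e.symm (fun k => trace (G k) (A N ω))

/-- The growth of the sum of the weights over the maps that are constant on the blocks of `π`. -/
theorem ControlledGrowth.isBigO_upSum (h : ControlledGrowth P A) (T : StarGraph L)
    (π : Setoid T.V) :
    (fun N => ∫ ω, upSum (weight T (A N ω)) π ∂P N) =O[atTop]
      fun N => (N : ℝ) ^
        (((∑ K : (T.quot π).Comps, ((T.quot π).conn K).numLeaves : ℕ) : ℝ) / 2) := by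
  have h1 := h.isBigO_prod_trace (fun K : (T.quot π).Comps => (T.quot π).conn K)
    fun K => StarGraph.conn_isTest _ K
  -- The factor `N` carried by each component compensates the `-1` in its growth exponent.
  have h2 : (fun N : ℕ => (N : ℂ) ^ Fintype.card (T.quot π).Comps) =O[atTop]
      fun N : ℕ => (N : ℝ) ^ (Fintype.card (T.quot π).Comps : ℝ) :=
    IsBigO.of_bound 1 (Eventually.of_forall fun N => by
      rw [Real.rpow_natCast, norm_pow, Complex.norm_natCast, norm_pow, Real.norm_natCast, one_mul])
  refine (h2.mul h1).congr' ?_ ?_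
  · filter_upwards [eventually_ne_atTop 0] with N hN
    simp only [upSum_weight_eq_prod T _ hN]
    exact (integral_const_mul _ _).symm
  · filter_upwards [eventually_gt_atTop 0] with N hN
    rw [← Real.rpow_add (by exact_mod_cast hN)]
    congr 1
    rw [Finset.sum_sub_distrib, ← Finset.sum_div]
    simp

end Limits

/-! ### Limits for the joint family -/

section Joint

open StarGraph

theorem tendsto_descFactorial_div_pow (n : ℕ) :
    Tendsto (fun N : ℕ => (N.descFactorial n : ℂ) / (N : ℂ) ^ n) atTop (𝓝 1) := by
  have h1 : Tendsto (fun N : ℕ => (N.descFactorial n : ℝ) / (N : ℝ) ^ n) atTop (𝓝 1) := by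
    refine (isEquivalent_iff_tendsto_one ?_).1 (isEquivalent_descFactorial n)
    filter_upwards [eventually_ne_atTop 0] with N hN
    exact pow_ne_zero _ (Nat.cast_ne_zero.2 hN)
  have h2 := (Complex.continuous_ofReal.tendsto 1).comp h1
  rw [Complex.ofReal_one] at h2
  refine h2.congr fun N => ?_
  simp

theorem isBigO_descFactorial_inv (n : ℕ) :
    (fun N : ℕ => (N.descFactorial n : ℂ)⁻¹) =O[atTop] fun N : ℕ => ((N : ℝ) ^ n)⁻¹ := by
  have h1 := (isEquivalent_descFactorial n).inv.isBigO
  refine IsBigO.trans (IsBigO.of_norm_le fun N => ?_) h1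
  simp

theorem isBigO_descFactorial (n : ℕ) :
    (fun N : ℕ => (N.descFactorial n : ℂ)) =O[atTop] fun N : ℕ => (N : ℝ) ^ n := by
  have h1 := (isEquivalent_descFactorial n).isBigO
  refine IsBigO.trans (IsBigO.of_norm_le fun N => ?_) h1
  simp

variable {L : Type u} {Ω : ℕ → Type*} [∀ N, MeasurableSpace (Ω N)]
  {P : ∀ N, Measure (Ω N)} [∀ N, IsProbabilityMeasure (P N)]
  {A : ∀ N, Ω N → L → Matrix (Fin N) (Fin N) ℂ}

theorem allMoments_upSum (hA : ∀ N l i j, AllMoments (fun ω => A N ω l i j) (P N)) (N : ℕ)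
    (T : StarGraph L) (π : Setoid T.V) :
    AllMoments (fun ω => upSum (weight T (A N ω)) π) (P N) := by
  classical
  simp only [upSum_eq_sum_quotient]
  exact allMoments_sum _ fun ψ _ => allMoments_weight (hA N) T _

theorem integral_kerSum_bot (hA : ∀ N l i j, AllMoments (fun ω => A N ω l i j) (P N)) (N : ℕ)
    (T : StarGraph L) : ∫ ω, kerSum (weight T (A N ω)) ⊥ ∂P N =
      ∑ π, moebius T.V π * ∫ ω, upSum (weight T (A N ω)) π ∂P N := by
  simp only [kerSum_bot]
  rw [integral_finsetSum]
  · exact Finset.sum_congr rfl fun π _ => integral_const_mul _ _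
  · exact fun π _ => ((allMoments_upSum hA N T π).const_mul _).integrable

theorem allMoments_transSum (hA : ∀ N l i j, AllMoments (fun ω => A N ω l i j) (P N)) (N : ℕ)
    (T : StarGraph L) (r : Setoid T.V) :
    AllMoments (fun ω => transSum (weight T (A N ω)) r) (P N) := by
  classical
  unfold transSum
  refine allMoments_sum _ fun φ _ => ?_
  split_ifs
  · exact allMoments_weight (hA N) T φ
  · exact allMoments_const 0

open Classical in
theorem integral_kerSum_bot_eq_sub (hA : ∀ N l i j, AllMoments (fun ω => A N ω l i j) (P N))
    (N : ℕ) (T : StarGraph L) (r : Setoid T.V) : ∫ ω, kerSum (weight T (A N ω)) ⊥ ∂P N =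
      ∫ ω, transSum (weight T (A N ω)) r ∂P N -
      ∑ ρ ∈ Finset.univ.filter (fun ρ => ρ ⊓ r = ⊥ ∧ ρ ≠ ⊥), ∑ π ∈ Finset.Ici ρ,
        IncidenceAlgebra.mu ℂ ρ π * ∫ ω, upSum (weight T (A N ω)) π ∂P N := by
  have hup : ∀ π, Integrable (fun ω => upSum (weight T (A N ω)) π) (P N) := fun π =>
    (allMoments_upSum hA N T π).integrable
  simp only [kerSum_bot_eq_transSum_sub _ r]
  rw [integral_sub (allMoments_transSum hA N T r).integrable, integral_finsetSum]
  · congr 1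
    refine Finset.sum_congr rfl fun ρ _ => ?_
    rw [integral_finsetSum _ fun π _ => (hup π).const_mul _]
    exact Finset.sum_congr rfl fun π _ => integral_const_mul _ _
  · exact fun ρ _ => integrable_finsetSum _ fun π _ => (hup π).const_mul _
  · exact integrable_finsetSum _ fun ρ _ => integrable_finsetSum _ fun π _ => (hup π).const_mul _

variable {p : ℕ} {ι : Fin p → Type u} {X : ∀ j, ∀ N, Ω N → ι j → Matrix (Fin N) (Fin N) ℂ}
  {τ : ∀ j, StarGraph (ι j) → ℂ} {T : StarGraph (Σ j, ι j)}

/-- The contribution of a color in a free product. -/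
theorem tendsto_kerSum_of_treeLike (hlim : ∀ j, HasLimitingTraffic P (X j) (τ j))
    (hconc : ∀ j, Concentrates P (X j) (τ j)) (hgrowth : ∀ j, ControlledGrowth P (X j))
    (h : T.TreeLike) (hT : T.IsCyclic) (j : Fin p) :
    Tendsto (fun N : ℕ => ((N : ℂ) ^ Fintype.card (Quotient (T.joinedIn j)))⁻¹ *
      ∫ ω, kerSum (weight (T.restrict j) (X j N ω)) ⊥ ∂P N) atTop
      (𝓝 (∏ K, injVersion (τ j) (T.colorPiece j K))) := by
  classical
  set k := Fintype.card (Quotient (T.joinedIn j)) with hk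
  have hmom := fun N => (hlim j).allMoments N
  -- Main term: maps injective on each component, where concentration gives the product of the
  -- limits.
  have h1 : Tendsto (fun N : ℕ => ((N : ℂ) ^ k)⁻¹ *
      ∫ ω, transSum (weight (T.restrict j) (X j N ω)) (T.joinedIn j) ∂P N) atTop
      (𝓝 (∏ K, injVersion (τ j) (T.colorPiece j K))) := by
    refine (tendsto_prod_injTrace (hlim j) (hconc j) (fun K => T.colorPiece j K)
      (fun K => h.colorPiece_isCyclic hT j K)).congr' ?_
    filter_upwards [eventually_ne_atTop 0] with N hN
    have hN' : (N : ℂ) ^ k ≠ 0 := pow_ne_zero _ (Nat.cast_ne_zero.2 hN)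
    simp only [transSum_weight_eq_prod_pieces (T.restrict j) (T.joinedIn j) (T.joinedIn_edge j) _ hN]
    exact ((congrArg (((N : ℂ) ^ k)⁻¹ * ·) (integral_const_mul _ _)).trans
      (inv_mul_cancel_left₀ hN' _)).symm
  have h2 : ∀ ρ : Setoid T.V, ρ ⊓ T.joinedIn j = ⊥ → ρ ≠ ⊥ → ∀ π, ρ ≤ π →
      Tendsto (fun N : ℕ => ((N : ℂ) ^ k)⁻¹ *
        ∫ ω, upSum (weight (T.restrict j) (X j N ω)) π ∂P N) atTop (𝓝 0) := by
    intro ρ hρ hρ0 π hπ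
    -- Otherwise `ρ` would lie below `T.joinedIn j`, and its meet with it would be `ρ` and not `⊥`.
    have hle : ¬ π ≤ T.joinedIn j := fun hle => hρ0 (by
      rw [← hρ, left_eq_inf]; exact hπ.trans hle)
    have hexp := h.sum_numLeaves_quot_le hT j π hle
    have hO := (hgrowth j).isBigO_upSum (T.restrict j) π
    set s := ∑ K : ((T.restrict j).quot π).Comps,
      (((T.restrict j).quot π).conn K).numLeaves with hs
    have hO1 : (fun N : ℕ => ((N : ℂ) ^ k)⁻¹) =O[atTop] fun N : ℕ => (N : ℝ) ^ (-(k : ℝ)) :=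
      IsBigO.of_bound 1 (Eventually.of_forall fun N => by
        rw [Real.rpow_neg (Nat.cast_nonneg N), Real.rpow_natCast]
        simp)
    refine (hO1.mul hO).trans_tendsto ?_
    have hneg : 0 < (k : ℝ) - (s : ℝ) / 2 := by
      have : (s : ℝ) + 2 ≤ 2 * k := by exact_mod_cast hexp
      linarith
    refine ((tendsto_rpow_neg_atTop hneg).comp tendsto_natCast_atTop_atTop).congr' ?_
    filter_upwards [eventually_gt_atTop 0] with N hN
    rw [← Real.rpow_add (by exact_mod_cast hN), Function.comp]
    congr 1
    ring
  have h3 := h1.sub (tendsto_finsetSum (Finset.univ.filter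
    (fun ρ => ρ ⊓ T.joinedIn j = ⊥ ∧ ρ ≠ ⊥)) fun ρ hρ => tendsto_finsetSum (Finset.Ici ρ)
      fun π hπ => (h2 ρ (Finset.mem_filter.1 hρ).2.1 (Finset.mem_filter.1 hρ).2.2 π
        (Finset.mem_Ici.1 hπ)).const_mul (IncidenceAlgebra.mu ℂ ρ π))
  simp only [mul_zero, Finset.sum_const_zero, sub_zero] at h3
  refine h3.congr fun N => ?_
  have h4 := integral_kerSum_bot_eq_sub hmom N (T.restrict j) (T.joinedIn j)
  rw [h4, mul_sub, Finset.mul_sum]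
  refine congrArg₂ _ rfl (Finset.sum_congr rfl fun ρ _ => ?_)
  rw [Finset.mul_sum]
  exact Finset.sum_congr rfl fun π _ => mul_left_comm _ _ _

/-- The functionals `τ j` are not assumed invariant under isomorphism of graphs. On cyclic graphs
they are determined as limits, so the equalities of injective traces at finite `N` pass to them; the
isolated vertices give one. -/
theorem prod_colorPiece_eq_prod_comp (hlim : ∀ j, HasLimitingTraffic P (X j) (τ j))
    (h : T.TreeLike) (hT : T.IsCyclic) :
    ∏ j, ∏ K, injVersion (τ j) (T.colorPiece j K) =
      ∏ C : T.ColorComp, injVersion (τ C.1.1) (T.comp C) := by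
  classical
  have h1 : ∀ C : T.ColorComp, injVersion (τ C.1.1) (T.comp C) =
      injVersion (τ C.1.1) (T.colorPiece C.1.1 C.1.2) := fun C => by
    refine tendsto_nhds_unique ((hlim C.1.1).tendsto_injTrace (h.comp_isCyclic hT C)) ?_
    simp only [injTrace_comp]
    exact (hlim C.1.1).tendsto_injTrace (h.colorPiece_isCyclic hT C.1.1 C.1.2)
  rw [← Fintype.prod_sigma' (fun j K => injVersion (τ j) (T.colorPiece j K))]
  simp only [h1]
  rw [← Fintype.prod_subtype_mul_prod_subtype (fun C : Σ j : Fin p, Quotient (T.joinedIn j) =>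
    ∃ e, (T.γ e).1 = C.1 ∧ Quotient.mk _ (T.src e) = C.2)]
  refine (congrArg₂ (· * ·) (prod_univ_congr fun _ => rfl) (Finset.prod_eq_one ?_)).trans
    (mul_one _)
  · rintro ⟨C, hC⟩ _
    refine tendsto_nhds_unique ((hlim C.1).tendsto_injTrace
      (h.colorPiece_isCyclic hT C.1 C.2)) (tendsto_const_nhds.congr' ?_)
    filter_upwards [eventually_ne_atTop 0] with N hN
    simp only [injTrace_of_isolated T C.1 C.2 hC hN]
    simp

/-- Convergence of the injective traces of the joint family at a free product. -/
theorem tendsto_injTrace_joint_of_treeLike (hmeas : ∀ j N, Measurable (X j N))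
    (hindep : ∀ N, iIndepFun (fun j => X j N) (P N)) (j₀ : Fin p)
    (hinv : ∀ j, j ≠ j₀ → PermInvariant P (X j))
    (hlim : ∀ j, HasLimitingTraffic P (X j) (τ j))
    (hconc : ∀ j, Concentrates P (X j) (τ j)) (hgrowth : ∀ j, ControlledGrowth P (X j))
    (h : T.TreeLike) (hT : T.IsCyclic) :
    Tendsto (fun N => ∫ ω, injTrace T (joint X N ω) ∂P N) atTop
      (𝓝 (∏ C : T.ColorComp, injVersion (τ C.1.1) (T.comp C))) := by
  rw [← prod_colorPiece_eq_prod_comp hlim h hT]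
  set n := Fintype.card T.V with hn
  have h1 := tendsto_finsetProd Finset.univ fun j _ =>
    tendsto_kerSum_of_treeLike hlim hconc hgrowth h hT j
  have h2 := ((tendsto_descFactorial_div_pow n).mul
    ((((tendsto_descFactorial_div_pow n).inv₀ one_ne_zero).pow p))).mul h1
  simp only [inv_one, one_pow, one_mul] at h2
  refine h2.congr' ?_
  filter_upwards [eventually_ge_atTop n, eventually_ne_atTop 0] with N hN hN0
  have hN' : (N : ℂ) ≠ 0 := Nat.cast_ne_zero.2 hN0
  rw [integral_injTrace_joint hmeas (fun j N => (hlim j).allMoments N) hindep j₀ hinv T N hN,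
    Finset.prod_mul_distrib, Finset.prod_mul_distrib, Finset.prod_const, Finset.card_univ,
    Fintype.card_fin, Finset.prod_inv_distrib, Finset.prod_pow_eq_pow_sum, ← hn]
  -- This is the equality `TreeLike` in the exponents: the powers of `N` balance exactly.
  have hexp : (N : ℂ) ^ (∑ j, Fintype.card (Quotient (T.joinedIn j))) * (N : ℂ) ^ n =
      ((N : ℂ) ^ n) ^ p * N := by
    rw [← pow_add, ← pow_mul, ← pow_succ, mul_comm n p]
    exact congrArg _ h
  have hS : (N : ℂ) ^ (∑ j, Fintype.card (Quotient (T.joinedIn j))) ≠ 0 := pow_ne_zero _ hN'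
  have hNn : (N : ℂ) ^ n ≠ 0 := pow_ne_zero _ hN'
  have hNnp : ((N : ℂ) ^ n) ^ p ≠ 0 := pow_ne_zero _ hNn
  generalize (N : ℂ) ^ (∑ j, Fintype.card (Quotient (T.joinedIn j))) = S at *
  generalize (∏ j, ∫ ω, kerSum (weight (T.restrict j) (X j N ω)) ⊥ ∂P N) = F
  generalize (N.descFactorial n : ℂ) = M
  generalize (N : ℂ) ^ n = Q at *
  rw [inv_div, div_pow, inv_pow]
  have key : Q ^ p * S⁻¹ * Q⁻¹ = (N : ℂ)⁻¹ := by
    field_simp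
    linear_combination -hexp
  rw [← key]
  ring

/-- Decay of the injective traces of the joint family at a graph that is not a free product. -/
theorem isBigO_injTrace_joint (hmeas : ∀ j N, Measurable (X j N))
    (hindep : ∀ N, iIndepFun (fun j => X j N) (P N)) (j₀ : Fin p)
    (hinv : ∀ j, j ≠ j₀ → PermInvariant P (X j))
    (hlim : ∀ j, HasLimitingTraffic P (X j) (τ j)) (hgrowth : ∀ j, ControlledGrowth P (X j))
    (h : ¬ T.TreeLike) (hT : T.IsCyclic) :
    (fun N => ∫ ω, injTrace T (joint X N ω) ∂P N) =O[atTop] fun N => (N : ℝ)⁻¹ := by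
  classical
  set n := Fintype.card T.V with hn
  have h1 : (fun N => ∏ j, ∫ ω, kerSum (weight (T.restrict j) (X j N ω)) ⊥ ∂P N) =O[atTop]
      fun N : ℕ => (N : ℝ) ^ ((p : ℝ) * n - n) := by
    -- All colours are expanded at once, because the leaf bound holds only for their total and not
    -- colour by colour.
    have : ∀ N, ∏ j, ∫ ω, kerSum (weight (T.restrict j) (X j N ω)) ⊥ ∂P N =
        ∑ π : ∀ _ : Fin p, Setoid T.V, ∏ j, (moebius T.V (π j) *
          ∫ ω, upSum (weight (T.restrict j) (X j N ω)) (π j) ∂P N) := fun N => by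
      rw [Finset.prod_congr rfl fun j _ =>
        integral_kerSum_bot (fun N => (hlim j).allMoments N) N (T.restrict j)]
      exact Fintype.prod_sum (fun j (π : Setoid T.V) => moebius T.V π *
        ∫ ω, upSum (weight (T.restrict j) (X j N ω)) π ∂P N)
    simp only [this]
    refine IsBigO.fun_sum fun π _ => ?_
    have h2 := IsBigO.finsetProd (s := Finset.univ) fun j _ =>
      ((hgrowth j).isBigO_upSum (T.restrict j) (π j)).const_mul_left (moebius T.V (π j))
    refine h2.trans (IsBigO.of_bound 1 ?_)
    filter_upwards [eventually_gt_atTop 0] with N hN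
    have hN' : (0 : ℝ) < N := by exact_mod_cast hN
    have hN1 : (1 : ℝ) ≤ N := by exact_mod_cast hN
    rw [← Real.rpow_sum_of_pos hN', one_mul, Real.norm_of_nonneg (by positivity),
      Real.norm_of_nonneg (by positivity)]
    refine Real.rpow_le_rpow_of_exponent_le hN1 ?_
    have hexp := sum_numLeaves_quot_le hT h π
    rw [← Finset.sum_div, ← Nat.cast_sum]
    have hexp' : ((∑ j, ∑ K : ((T.restrict j).quot (π j)).Comps,
      (((T.restrict j).quot (π j)).conn K).numLeaves : ℕ) : ℝ) + 2 * n ≤ 2 * (p * n) := by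
        exact_mod_cast hexp
    linarith
  have h0 : (fun N : ℕ => (N : ℂ)⁻¹) =O[atTop] fun N : ℕ => (N : ℝ)⁻¹ :=
    IsBigO.of_bound 1 (Eventually.of_forall fun N => by simp)
  have h3 := h0.mul (((isBigO_descFactorial n).mul ((isBigO_descFactorial_inv n).pow p)).mul h1)
  refine h3.congr' ?_ ?_
  · filter_upwards [eventually_ge_atTop n] with N hN
    rw [integral_injTrace_joint hmeas (fun j N => (hlim j).allMoments N) hindep j₀ hinv T N hN,
      Finset.prod_mul_distrib, Finset.prod_const, Finset.card_univ, Fintype.card_fin, ← hn]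
    ring
  · filter_upwards [eventually_gt_atTop 0] with N hN
    have hN' : (0 : ℝ) < N := by exact_mod_cast hN
    rw [Real.rpow_sub hN', Real.rpow_natCast, mul_comm (p : ℝ), Real.rpow_mul hN'.le,
      Real.rpow_natCast, Real.rpow_natCast, inv_pow]
    field_simp

/-- Convergence of the injective traces of the joint family. -/
theorem tendsto_injTrace_joint (hmeas : ∀ j N, Measurable (X j N))
    (hindep : ∀ N, iIndepFun (fun j => X j N) (P N)) (j₀ : Fin p)
    (hinv : ∀ j, j ≠ j₀ → PermInvariant P (X j))
    (hlim : ∀ j, HasLimitingTraffic P (X j) (τ j))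
    (hconc : ∀ j, Concentrates P (X j) (τ j)) (hgrowth : ∀ j, ControlledGrowth P (X j))
    (hT : T.IsCyclic) :
    Tendsto (fun N => ∫ ω, injTrace T (joint X N ω) ∂P N) atTop (𝓝 (freeProductInj τ T)) := by
  classical
  by_cases h : T.IsFreeProduct
  · rw [freeProductInj, if_pos h]
    exact tendsto_injTrace_joint_of_treeLike hmeas hindep j₀ hinv hlim hconc hgrowth
      ((isFreeProduct_iff hT.1).1 h) hT
  · rw [freeProductInj, if_neg h]
    exact (isBigO_injTrace_joint hmeas hindep j₀ hinv hlim hgrowth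
      (fun h' => h ((isFreeProduct_iff hT.1).2 h')) hT).trans_tendsto tendsto_inv_atTop_nhds_zero_nat

theorem hasLimitingTraffic_joint (hmeas : ∀ j N, Measurable (X j N))
    (hindep : ∀ N, iIndepFun (fun j => X j N) (P N)) (j₀ : Fin p)
    (hinv : ∀ j, j ≠ j₀ → PermInvariant P (X j))
    (hlim : ∀ j, HasLimitingTraffic P (X j) (τ j))
    (hconc : ∀ j, Concentrates P (X j) (τ j)) (hgrowth : ∀ j, ControlledGrowth P (X j)) :
    HasLimitingTraffic P (joint X) (trafficFreeProduct τ) := by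
  refine ⟨fun N l => (hlim l.1).1 N l.2, fun T hT => ?_⟩
  have hmom : ∀ N l a b, AllMoments (fun ω => joint X N ω l a b) (P N) :=
    fun N l => (hlim l.1).1 N l.2
  simp only [trace_eq_sum_injTrace_quot]
  refine (tendsto_finsetSum Finset.univ fun π _ => tendsto_injTrace_joint hmeas hindep j₀ hinv hlim
    hconc hgrowth (hT.quot π)).congr fun N => ?_
  exact (integral_finsetSum _ fun π _ => (allMoments_injTrace (hmom N) _).integrable).symm

/-- Both sides of the rule are limits of the same injective traces, so uniqueness of limits gives it
without inverting the definition of the product. For a component, the joint family reduces to its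
own family. -/
theorem isTrafficFree_trafficFreeProduct (hmeas : ∀ j N, Measurable (X j N))
    (hindep : ∀ N, iIndepFun (fun j => X j N) (P N)) (j₀ : Fin p)
    (hinv : ∀ j, j ≠ j₀ → PermInvariant P (X j))
    (hlim : ∀ j, HasLimitingTraffic P (X j) (τ j))
    (hconc : ∀ j, Concentrates P (X j) (τ j)) (hgrowth : ∀ j, ControlledGrowth P (X j)) :
    IsTrafficFree (trafficFreeProduct τ) := by
  have hjoint := hasLimitingTraffic_joint hmeas hindep j₀ hinv hlim hconc hgrowth
  intro T hT
  have h1 : injVersion (trafficFreeProduct τ) T = freeProductInj τ T :=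
    tendsto_nhds_unique (hjoint.tendsto_injTrace hT)
      (tendsto_injTrace_joint hmeas hindep j₀ hinv hlim hconc hgrowth hT)
  rw [h1]
  refine ⟨fun h => ?_, fun h => if_neg h⟩
  rw [freeProductInj, if_pos h]
  refine Finset.prod_congr rfl fun C _ => ?_
  have hC := ((isFreeProduct_iff hT.1).1 h).comp_isCyclic hT C
  have hC' : ((T.comp C).map (Sigma.mk (β := ι) C.1.1)).IsCyclic :=
    isCyclic_of_equiv (Equiv.refl _) (Equiv.refl _) (fun _ => rfl) (fun _ => rfl) hC
  have htr : ∀ N ω, injTrace ((T.comp C).map (Sigma.mk (β := ι) C.1.1)) (joint X N ω) =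
      injTrace (T.comp C) (X C.1.1 N ω) := by
    intro N ω
    rfl
  have h2 := hjoint.tendsto_injTrace hC'
  simp only [htr] at h2
  exact tendsto_nhds_unique ((hlim C.1.1).tendsto_injTrace hC) h2

end Joint

/-! ### Words as directed cycles, and the limiting `*`-distribution -/

section Words

open StarGraph

variable {L : Type u} {N : ℕ}

theorem wordGraph_isCyclic (w : List (L × Bool)) : (wordGraph w).IsCyclic := by
  rw [isCyclic_iff_exists_fin]
  refine ⟨⟨⟨(0 : Fin (w.length - 1 + 1))⟩, ?_⟩, w.length, Equiv.refl _, fun k => ?_⟩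
  · have h : ∀ i (hi : i < w.length - 1 + 1),
        (wordGraph w).joinedBy Set.univ (0 : Fin (w.length - 1 + 1)) ⟨i, hi⟩ := by
      intro i
      induction i with
      | zero => exact fun _ => Setoid.refl' _ _
      | succ i ih =>
        intro hi
        refine Setoid.trans' _ (ih (by omega)) ?_
        have := (wordGraph w).joinedBy_univ_edge (⟨i, by omega⟩ : Fin w.length)
        have h1 : (wordGraph w).src (⟨i, by omega⟩ : Fin w.length) =
            (⟨i, by omega⟩ : Fin (w.length - 1 + 1)) := Fin.ext (Nat.mod_eq_of_lt (by omega))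
        have h2 : (wordGraph w).tgt (⟨i, by omega⟩ : Fin w.length) =
            (⟨i + 1, hi⟩ : Fin (w.length - 1 + 1)) := Fin.ext (Nat.mod_eq_of_lt (by omega))
        rwa [h1, h2] at this
    intro v w'
    exact Setoid.trans' _ (Setoid.symm' _ (h v.1 v.2)) (h w'.1 w'.2)
  · have hk := k.2
    refine Fin.ext ?_
    change (k.1 + 1) % (w.length - 1 + 1) = (finRotate _ k).1 % (w.length - 1 + 1)
    rw [val_finRotate]
    split_ifs with h
    · rfl
    · rw [Nat.zero_mod, show k.1 + 1 = w.length - 1 + 1 by omega, Nat.mod_self]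

/-- The indices visited are `a`, then `ψ`, then `b`: `Fin.cons a ψ` lists the left indices of the
factors and `Fin.snoc ψ b` the right ones. -/
theorem prod_ofFn_apply {m : ℕ} (M : Fin (m + 1) → Matrix (Fin N) (Fin N) ℂ) (a b : Fin N) :
    (List.ofFn M).prod a b = ∑ ψ : Fin m → Fin N,
      ∏ k, M k ((Fin.cons a ψ : Fin (m + 1) → Fin N) k) ((Fin.snoc ψ b : Fin (m + 1) → Fin N) k) := by
  induction m generalizing a with
  | zero => simp [Fin.snoc]
  | succ m ih =>
    rw [List.ofFn_succ, List.prod_cons, Matrix.mul_apply,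
      ← Equiv.sum_comp (Fin.consEquiv fun _ : Fin (m + 1) => Fin N), Fintype.sum_prod_type]
    refine Finset.sum_congr rfl fun x _ => ?_
    rw [ih, Finset.mul_sum]
    refine Finset.sum_congr rfl fun ψ _ => ?_
    have hc : (Fin.consEquiv fun _ : Fin (m + 1) => Fin N) (x, ψ) = Fin.cons x ψ := rfl
    rw [hc]
    refine Eq.trans ?_ (Fin.prod_univ_succ _).symm
    simp only [Fin.cons_zero, Fin.cons_succ]
    have h0 : (Fin.snoc (Fin.cons x ψ : Fin (m + 1) → Fin N) b : Fin (m + 2) → Fin N) 0 = x := by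
      rw [← Fin.cons_snoc_eq_snoc_cons, Fin.cons_zero]
    have hs : ∀ k, (Fin.snoc (Fin.cons x ψ : Fin (m + 1) → Fin N) b : Fin (m + 2) → Fin N) k.succ =
        (Fin.snoc ψ b : Fin (m + 1) → Fin N) k := fun k => by
      rw [← Fin.cons_snoc_eq_snoc_cons, Fin.cons_succ]
    rw [h0]
    simp only [hs]

theorem trace_prod_ofFn {m : ℕ} (M : Fin (m + 1) → Matrix (Fin N) (Fin N) ℂ) :
    Matrix.trace (List.ofFn M).prod =
      ∑ φ : Fin (m + 1) → Fin N, ∏ k, M k (φ k) (φ (Fin.ofNat (m + 1) (k.1 + 1))) := by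
  rw [Matrix.trace, ← Equiv.sum_comp (Fin.consEquiv fun _ : Fin (m + 1) => Fin N),
    Fintype.sum_prod_type]
  refine Finset.sum_congr rfl fun a _ => ?_
  rw [Matrix.diag_apply, prod_ofFn_apply]
  refine Finset.sum_congr rfl fun ψ _ => Finset.prod_congr rfl fun k _ => ?_
  simp only [Fin.consEquiv_apply]
  congr 1
  induction k using Fin.lastCases with
  | last =>
    rw [Fin.snoc_last]
    have : Fin.ofNat (m + 1) ((Fin.last m).1 + 1) = 0 := Fin.ext (by simp)
    rw [this, Fin.cons_zero]
  | cast k =>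
    rw [Fin.snoc_castSucc]
    have : Fin.ofNat (m + 1) (k.castSucc.1 + 1) = k.succ :=
      Fin.ext (Nat.mod_eq_of_lt (Nat.succ_lt_succ k.2))
    rw [this, Fin.cons_succ]

theorem trace_wordGraph (w : List (L × Bool)) (A : L → Matrix (Fin N) (Fin N) ℂ) :
    trace (wordGraph w) A = (N : ℂ)⁻¹ * Matrix.trace (w.map (letter A)).prod := by
  classical
  rw [trace_eq_sum_weight]
  congr 1
  obtain ⟨K, f, rfl⟩ : ∃ (K : ℕ) (f : Fin K → L × Bool), w = List.ofFn f :=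
    ⟨w.length, w.get, (List.ofFn_get w).symm⟩
  cases K with
  | zero =>
    have h : ∀ φ, weight (wordGraph (List.ofFn f)) A φ = 1 := fun φ => by
      have : IsEmpty (wordGraph (List.ofFn f)).E := by
        change IsEmpty (Fin (List.ofFn f).length)
        rw [List.length_ofFn]
        infer_instance
      exact Fintype.prod_empty _
    simp only [h, List.ofFn_zero, List.map_nil, List.prod_nil, Matrix.trace_one]
    rw [Finset.sum_const, Finset.card_univ, Fintype.card_fun]
    simp only [Fintype.card_fin]
    have : Fintype.card (wordGraph (List.ofFn f)).V = 1 := by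
      change Fintype.card (Fin ((List.ofFn f).length - 1 + 1)) = 1
      simp
    rw [this]
    simp
  | succ m =>
    rw [List.map_ofFn, trace_prod_ofFn]
    have hlen : (List.ofFn f).length = m + 1 := List.length_ofFn
    let eV : Fin (m + 1) ≃ (wordGraph (List.ofFn f)).V :=
      finCongr (show m + 1 = (List.ofFn f).length - 1 + 1 by omega)
    let eE : Fin (m + 1) ≃ (wordGraph (List.ofFn f)).E := finCongr hlen.symm
    refine Fintype.sum_equiv (Equiv.arrowCongr eV.symm (Equiv.refl _)) _ _ fun φ => ?_
    refine (Fintype.prod_equiv eE _ _ fun k => ?_).symm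
    have hγ : ((wordGraph (List.ofFn f)).γ (eE k), (wordGraph (List.ofFn f)).ε (eE k)) = f k := by
      change (List.ofFn f).get (eE k) = f k
      exact (List.get_ofFn f (eE k)).trans rfl
    have hs : (wordGraph (List.ofFn f)).src (eE k) = eV k :=
      Fin.ext (Nat.mod_eq_of_lt (show k.1 < (List.ofFn f).length - 1 + 1 by have := k.2; omega))
    have ht : (wordGraph (List.ofFn f)).tgt (eE k) = eV (Fin.ofNat (m + 1) (k.1 + 1)) := by
      refine Fin.ext ?_
      change (k.1 + 1) % ((List.ofFn f).length - 1 + 1) = (k.1 + 1) % (m + 1)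
      rw [hlen, Nat.add_sub_cancel]
    rw [hγ, hs, ht]
    rfl

theorem evalPoly_eq_sum (A : L → Matrix (Fin N) (Fin N) ℂ) (Q : FreeAlgebra ℂ (L × Bool)) :
    evalPoly A Q = (FreeAlgebra.equivMonoidAlgebraFreeMonoid Q).coeff.sum
      fun w c => c • ((FreeMonoid.toList w).map (letter A)).prod := by
  have h : FreeAlgebra.lift ℂ (letter A) =
      (MonoidAlgebra.lift ℂ (Matrix (Fin N) (Fin N) ℂ) (FreeMonoid (L × Bool))
        (FreeMonoid.lift (letter A))).comp
        (FreeAlgebra.equivMonoidAlgebraFreeMonoid (R := ℂ) (X := L × Bool)).toAlgHom := by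
    refine FreeAlgebra.hom_ext (funext fun x => ?_)
    simp [FreeAlgebra.equivMonoidAlgebraFreeMonoid]
  rw [evalPoly, h]
  refine (MonoidAlgebra.lift_apply (R := ℂ) (FreeMonoid.lift (letter A)) _).trans ?_
  simp only [FreeMonoid.lift_apply]
  rfl

theorem trace_evalPoly (A : L → Matrix (Fin N) (Fin N) ℂ) (Q : FreeAlgebra ℂ (L × Bool)) :
    (N : ℂ)⁻¹ * Matrix.trace (evalPoly A Q) =
      (FreeAlgebra.equivMonoidAlgebraFreeMonoid Q).coeff.sum
        fun w c => c * trace (wordGraph (FreeMonoid.toList w)) A := by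
  rw [evalPoly_eq_sum, Finsupp.sum, Finsupp.sum, Matrix.trace_sum, Finset.mul_sum]
  refine Finset.sum_congr rfl fun w _ => ?_
  rw [Matrix.trace_smul, trace_wordGraph, smul_eq_mul]
  ring

/-- A family with a limiting distribution of traffics has a limiting `*`-distribution. -/
theorem HasLimitingTraffic.tendsto_starDistribution {Ω : ℕ → Type*} [∀ N, MeasurableSpace (Ω N)]
    {P : ∀ N, Measure (Ω N)} [∀ N, IsProbabilityMeasure (P N)]
    {A : ∀ N, Ω N → L → Matrix (Fin N) (Fin N) ℂ} {τ : StarGraph L → ℂ}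
    (h : HasLimitingTraffic P A τ) (Q : FreeAlgebra ℂ (L × Bool)) :
    Tendsto (fun N => ∫ ω, (N : ℂ)⁻¹ * Matrix.trace (evalPoly (A N ω) Q) ∂P N) atTop
      (𝓝 (starDistribution τ Q)) := by
  simp only [trace_evalPoly]
  unfold starDistribution Finsupp.sum
  refine (tendsto_finsetSum _ fun w _ => (h.2 _ (wordGraph_isCyclic _)).const_mul _).congr
    fun N => ?_
  rw [integral_finsetSum]
  · exact Finset.sum_congr rfl fun w _ => (integral_const_mul _ _).symm
  · exact fun w _ => ((allMoments_trace (h.allMoments N) _).const_mul _).integrable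

end Words

end Traffic

theorem theorem3 {p : ℕ} {ι : Fin p → Type*}
    {Ω : ℕ → Type*} [∀ N, MeasurableSpace (Ω N)]
    (P : ∀ N, Measure (Ω N)) [∀ N, IsProbabilityMeasure (P N)]
    (X : ∀ j, ∀ N, Ω N → ι j → Matrix (Fin N) (Fin N) ℂ)
    (hmeas : ∀ j N, Measurable (X j N))
    (hindep : ∀ N, iIndepFun (fun j => X j N) (P N))
    (j₀ : Fin p) (hinv : ∀ j, j ≠ j₀ → Traffic.PermInvariant P (X j))
    (τ : ∀ j, Traffic.StarGraph (ι j) → ℂ)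
    (hlim : ∀ j, Traffic.HasLimitingTraffic P (X j) (τ j))
    (hconc : ∀ j, Traffic.Concentrates P (X j) (τ j))
    (hgrowth : ∀ j, Traffic.ControlledGrowth P (X j)) :
    Traffic.HasLimitingTraffic P (Traffic.joint X) (Traffic.trafficFreeProduct τ) ∧
    Traffic.IsTrafficFree (Traffic.trafficFreeProduct τ) ∧
    (∀ T : Traffic.StarGraph (Σ j, ι j), T.IsCyclic → ¬ T.IsFreeProduct →
      (fun N => ∫ ω, Traffic.injTrace T (Traffic.joint X N ω) ∂P N) =O[atTop]
        fun N => (N : ℝ)⁻¹) ∧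
    (∀ Q : FreeAlgebra ℂ ((Σ j, ι j) × Bool),
      Tendsto
        (fun N => ∫ ω, (N : ℂ)⁻¹ *
          Matrix.trace (Traffic.evalPoly (Traffic.joint X N ω) Q) ∂P N)
        atTop (𝓝 (Traffic.starDistribution (Traffic.trafficFreeProduct τ) Q))) := by
  have hjoint := Traffic.hasLimitingTraffic_joint hmeas hindep j₀ hinv hlim hconc hgrowth
  refine ⟨hjoint,
    Traffic.isTrafficFree_trafficFreeProduct hmeas hindep j₀ hinv hlim hconc hgrowth,
    fun T hT h => ?_, fun Q => hjoint.tendsto_starDistribution Q⟩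
  exact Traffic.isBigO_injTrace_joint hmeas hindep j₀ hinv hlim hgrowth
    (fun h' => h ((Traffic.StarGraph.isFreeProduct_iff hT.1).2 h')) hT
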